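/- A tournament $T$ on a vertex set $V$ is a loopless digraph on $V$ such that, for any two distinct vertices $x,y$, exactly one of $(x,y)$, $(y,x)$ is an arc; it is acyclic if it contains no $3$-cycle. A set $X\subseteq V$ is an interval of $T$ if for all $x,x'\in X$ and $y\in V\setminus X$, $(x,y)$ is an arc iff $(x',y)$ is, and $(y,x)$ is an arc iff $(y,x')$ is. $T$ is indecomposable if its only intervals are $\emptyset$, $V$ and the singletons, and decomposable otherwise. $T$ is critical if it is non-empty, finite and indecomposable and, for every vertex $x$, the tournament $T-x$ induced on $V\setminus\{x\}$ is decomposable. For $X\subseteq V$, $\mathrm{Inv}(T,X)$ is obtained from $T$ by reversing all arcs with both ends in $X$, and $\mathrm{Inv}(T,(X_0,\dots,X_{m-1}))$ by doing this successively for $X_0,\dots,X_{m-1}$. Let $\underline{m}$ be the tournament on $\{0,\dots,m-1\}$ with arcs $(i,j)$, $i<j$, and put $2\mathbb N_{<k}=\{2i: 0\le i<k\}$, $2\mathbb N_{<k}+1=\{2i+1: 0\le i<k\}$. Theorem. Up to isomorphism, the critical tournaments are exactly the tournaments $$U_{2n+1}=\mathrm{Inv}(\underline{2n+1},\,2\mathbb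 N_{<n+1}),\quad T_{2n+1}=\mathrm{Inv}(\underline{2n+1},(2\mathbb N_{<n+1},\,2\mathbb N_{<n}+1)),\quad V_{2n+1}=\mathrm{Inv}(\underline{2n+1},(2\mathbb N_{<n+1},\,2\mathbb N_{<n})),$$ with $n\ge 2$: a tournament is critical if and only if it is isomorphic to one of them, and for each $n\ge2$ the three tournaments $U_{2n+1}$, $T_{2n+1}$, $V_{2n+1}$ are pairwise non-isomorphic. In particular, every critical tournament is of the form $\mathrm{Inv}(L,X)$ or $\mathrm{Inv}(L,(X,Y))$ for some acyclic tournament $L$ on the same vertex set $V$ and some $X,Y\subseteq V$. -/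

import Mathlib

/-- A tournament on the vertex set `V`: a digraph without loops in which, for any two distinct
vertices `x`, `y`, exactly one of `(x, y)` and `(y, x)` is an arc. -/
structure Tournament (V : Type*) extends Digraph V where
  loopless : ∀ x, ¬ Adj x x
  adj_xor : ∀ x y, x ≠ y → Xor (Adj x y) (Adj y x)

namespace Tournament

/-- Isomorphism of tournaments. -/
def Isomorphic {V W : Type*} (T : Tournament V) (S : Tournament W) : Prop :=
  Nonempty (T.Adj ≃r S.Adj)

/-- The tournament induced by `T` on a set `X` of vertices. -/
def induce {V : Type*} (T : Tournament V) (X : Set V) : Tournament X where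
  Adj x y := T.Adj x y
  loopless x := T.loopless x
  adj_xor x y h := T.adj_xor x y (fun e => h (Subtype.ext e))

/-- The tournament `T - x`. -/
def delete {V : Type*} (T : Tournament V) (x : V) : Tournament ({x}ᶜ : Set V) :=
  T.induce {x}ᶜ

/-- A tournament is acyclic (transitive) if it contains no `3`-cycle. -/
def IsAcyclic {V : Type*} (T : Tournament V) : Prop :=
  ¬ ∃ x y z, T.Adj x y ∧ T.Adj y z ∧ T.Adj z x

/-- `X` is an interval of `T` if no vertex outside `X` distinguishes two vertices of `X`. -/
def IsInterval {V : Type*} (T : Tournament V) (X : Set V) : Prop :=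
  ∀ y, y ∉ X → ∀ x ∈ X, ∀ x' ∈ X,
    (T.Adj x y ↔ T.Adj x' y) ∧ (T.Adj y x ↔ T.Adj y x')

/-- A tournament is indecomposable if its only intervals are `∅`, the singletons and the whole
vertex set. -/
def IsIndecomposable {V : Type*} (T : Tournament V) : Prop :=
  ∀ X : Set V, T.IsInterval X → X = ∅ ∨ (∃ x, X = {x}) ∨ X = Set.univ

/-- A tournament is critical if it is non-empty, finite and indecomposable, and `T - x` is
decomposable for every vertex `x`. -/
def IsCritical {V : Type*} (T : Tournament V) : Prop :=
  Nonempty V ∧ Finite V ∧ T.IsIndecomposable ∧ ∀ x, ¬ (T.delete x).IsIndecomposable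

/-- `Inv(T, X)`: the tournament obtained from `T` by reversing all arcs with both ends in `X`. -/
def inv {V : Type*} (T : Tournament V) (X : Set V) : Tournament V where
  Adj x y := (x ∈ X ∧ y ∈ X ∧ T.Adj y x) ∨ (¬ (x ∈ X ∧ y ∈ X) ∧ T.Adj x y)
  loopless x := by
    have := T.loopless x
    tauto
  adj_xor x y h := by
    have := T.adj_xor x y h
    rw [xor_def] at *
    tauto

/-- `Inv(T, (X₀, …, X_{m-1}))`: invert successively `X₀`, …, `X_{m-1}`. -/
def invList {V : Type*} (T : Tournament V) (Xs : List (Set V)) : Tournament V :=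
  Xs.foldl inv T

/-- The transitive tournament on `{0, …, m - 1}`, with arcs `(i, j)` for `i < j`. -/
def std (m : ℕ) : Tournament (Fin m) where
  Adj i j := i < j
  loopless i := lt_irrefl i
  adj_xor i j h := by
    rcases lt_or_gt_of_ne h with h | h
    · exact Or.inl ⟨h, lt_asymm h⟩
    · exact Or.inr ⟨h, lt_asymm h⟩

/-- `{2i : i < k}`, as a set of vertices of the tournament on `{0, …, m - 1}`. -/
def evens (m k : ℕ) : Set (Fin m) := {v | ∃ i < k, (v : ℕ) = 2 * i}

/-- `{2i + 1 : i < k}`, as a set of vertices of the tournament on `{0, …, m - 1}`. -/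
def odds (m k : ℕ) : Set (Fin m) := {v | ∃ i < k, (v : ℕ) = 2 * i + 1}

/-- The tournament `U_{2n+1}`. -/
def tournU (n : ℕ) : Tournament (Fin (2 * n + 1)) :=
  (std (2 * n + 1)).invList [evens (2 * n + 1) (n + 1)]

/-- The tournament `T_{2n+1}`. -/
def tournT (n : ℕ) : Tournament (Fin (2 * n + 1)) :=
  (std (2 * n + 1)).invList [evens (2 * n + 1) (n + 1), odds (2 * n + 1) n]

/-- The tournament `V_{2n+1}`. -/
def tournV (n : ℕ) : Tournament (Fin (2 * n + 1)) :=
  (std (2 * n + 1)).invList [evens (2 * n + 1) (n + 1), evens (2 * n + 1) n]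

end Tournament

/-!
The proof studies the indecomposability graph of a critical tournament `T`, in which `x` and `y`
are linked when `T - {x, y}` is indecomposable (`Linked`).

The graph has an edge. By the Ehrenfeucht–Rozenberg argument
(`IsIndecomposableOn.exists_insert_insert`), a proper indecomposable set of at least three vertices
which no single vertex enlarges to an indecomposable set is enlarged by some two vertices. Since `T`
contains a `3`-cycle, there is a maximal proper indecomposable set of at least three vertices; it
cannot miss exactly one vertex, as `T` is critical, so it misses exactly two, which are linked
(`IsCritical.exists_linked`).

Let `x` be linked to `y`. As `T - x` is decomposable and `T - {x, y}` is not, either `y` is a source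
or a sink of `T - x`, and then `y` is the only neighbour of `x`, or `y` has a twin `z` in `T - x`,
and then the neighbours of `x` are `y` and `z`. So all degrees are at most two, and a longest path
`x 0, …, x k` either closes up to a cycle or has two ends of degree one
(`IsCritical.uniform_or_linked_ends`).

The twin relations determine the arcs. After a possible reversal of the path, all arcs between
positions of different parities follow the path, the arcs between even positions have one common
direction, and so have those between odd positions (`IsLinkedPath.adj_of_odd`,
`IsLinkedPath.adj_iff_of_even`); a vertex off the path sees only parities. A cycle leaves room for
no further vertex, and both parity classes are reversed: this is `T_{2n+1}`. If the ends have degree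
one, then `x 1` is nearly a source and `x (k - 1)` nearly a sink; for even `k` this excludes further
vertices and reverses exactly the even positions, giving `U_{2n+1}`, while for odd `k` the path is
transitive and there is exactly one further vertex, giving `V_{2n+1}`.

Conversely, in each family any two vertices generate everything under adding vertices that
distinguish two vertices already present, and each deletion creates twins, a source or a sink. The
families are told apart by the number of vertices with exactly one in-neighbour, which is one for
`U_{2n+1}`, zero for `T_{2n+1}` and at least two for `V_{2n+1}`.
-/

namespace Tournament

variable {V W : Type*}

/-! ### Intervals relative to a set of vertices -/

theorem adj_iff_not_adj (T : Tournament V) {x y : V} (h : x ≠ y) : T.Adj x y ↔ ¬ T.Adj y x := by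
  have := T.adj_xor x y h
  rw [xor_def] at this
  tauto

theorem ne_of_adj {T : Tournament V} {x y : V} (h : T.Adj x y) : x ≠ y := by
  rintro rfl
  exact T.loopless x h

/-- `I` is an interval of the subtournament of `T` induced on `A`. In a tournament it is enough to
compare the arcs that leave the outer vertex. -/
def IsIntervalIn (T : Tournament V) (A I : Set V) : Prop :=
  I ⊆ A ∧ ∀ y ∈ A, y ∉ I → ∀ x ∈ I, ∀ x' ∈ I, (T.Adj y x ↔ T.Adj y x')

/-- The subtournament of `T` induced on `A` is indecomposable. -/
def IsIndecomposableOn (T : Tournament V) (A : Set V) : Prop :=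
  ∀ I, T.IsIntervalIn A I → I.Subsingleton ∨ I = A

theorem isIndecomposable_iff_univ (T : Tournament V) :
    T.IsIndecomposable ↔ T.IsIndecomposableOn Set.univ := by
  have h1 : ∀ X : Set V, T.IsInterval X ↔ T.IsIntervalIn Set.univ X := by
    intro X
    constructor
    · exact fun h => ⟨Set.subset_univ _, fun y _ hy x hx x' hx' => (h y hy x hx x' hx').2⟩
    · rintro ⟨-, h⟩ y hy x hx x' hx'
      have key := h y trivial hy x hx x' hx'
      refine ⟨?_, key⟩
      rw [T.adj_iff_not_adj (ne_of_mem_of_not_mem hx hy),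
        T.adj_iff_not_adj (ne_of_mem_of_not_mem hx' hy), key]
  unfold IsIndecomposable IsIndecomposableOn
  refine forall_congr' fun X => ?_
  rw [h1, ← or_assoc]
  refine imp_congr_right fun _ => or_congr_left ?_
  constructor
  · rintro (rfl | ⟨x, rfl⟩) <;> simp
  · exact Set.Subsingleton.eq_empty_or_singleton

/-- An arc-preserving map transports indecomposability; it is automatically injective because a
tournament has no loops. -/
theorem isIndecomposableOn_image {T : Tournament V} {S : Tournament W} {A : Set V} {f : V → W}
    (hf : ∀ a ∈ A, ∀ b ∈ A, (S.Adj (f a) (f b) ↔ T.Adj a b)) :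
    S.IsIndecomposableOn (f '' A) ↔ T.IsIndecomposableOn A := by
  have hinj : Set.InjOn f A := by
    intro a ha b hb hab
    by_contra hne
    have h1 := hf a ha b hb
    have h2 := hf b hb a ha
    rw [hab] at h1 h2
    have := S.loopless (f b)
    have := T.adj_iff_not_adj hne
    tauto
  constructor
  · rintro h I ⟨hIA, hI⟩
    have : S.IsIntervalIn (f '' A) (f '' I) := by
      refine ⟨Set.image_mono hIA, ?_⟩
      rintro _ ⟨y, hy, rfl⟩ hyI _ ⟨x, hx, rfl⟩ _ ⟨x', hx', rfl⟩
      rw [hf y hy x (hIA hx), hf y hy x' (hIA hx')]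
      exact hI y hy (fun h => hyI ⟨y, h, rfl⟩) x hx x' hx'
    rcases h _ this with h | h
    · left
      intro x hx x' hx'
      exact hinj (hIA hx) (hIA hx') (h ⟨x, hx, rfl⟩ ⟨x', hx', rfl⟩)
    · right
      exact (hinj.image_eq_image_iff hIA subset_rfl).1 h
  · rintro h J ⟨hJA, hJ⟩
    have hJf : f '' (A ∩ f ⁻¹' J) = J := by
      ext z
      constructor
      · rintro ⟨x, ⟨-, hx⟩, rfl⟩
        exact hx
      · intro hz
        obtain ⟨x, hx, rfl⟩ := hJA hz
        exact ⟨x, ⟨hx, hz⟩, rfl⟩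
    have : T.IsIntervalIn A (A ∩ f ⁻¹' J) := by
      refine ⟨Set.inter_subset_left, ?_⟩
      rintro y hy hyI x ⟨hx, hxJ⟩ x' ⟨hx', hxJ'⟩
      rw [← hf y hy x hx, ← hf y hy x' hx']
      exact hJ _ ⟨y, hy, rfl⟩ (fun h => hyI ⟨hy, h⟩) _ hxJ _ hxJ'
    rcases h _ this with h | h
    · left
      rw [← hJf]
      exact h.image f
    · right
      rw [← hJf, h]

theorem isIndecomposable_induce_iff (T : Tournament V) (A : Set V) :
    (T.induce A).IsIndecomposable ↔ T.IsIndecomposableOn A := by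
  rw [isIndecomposable_iff_univ,
    ← isIndecomposableOn_image (S := T) (f := Subtype.val) (fun _ _ _ _ => Iff.rfl)]
  simp

theorem isCritical_iff (T : Tournament V) : T.IsCritical ↔ Nonempty V ∧ Finite V ∧
    T.IsIndecomposableOn Set.univ ∧ ∀ x, ¬ T.IsIndecomposableOn {x}ᶜ := by
  simp only [IsCritical, delete, isIndecomposable_induce_iff, T.isIndecomposable_iff_univ]

theorem Isomorphic.isCritical {T : Tournament V} {S : Tournament W} (h : T.Isomorphic S)
    (hS : S.IsCritical) : T.IsCritical := by
  obtain ⟨e⟩ := h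
  rw [isCritical_iff] at *
  obtain ⟨h1, h2, h3, h4⟩ := hS
  have he : ∀ A : Set V, S.IsIndecomposableOn (e '' A) ↔ T.IsIndecomposableOn A :=
    fun A => isIndecomposableOn_image fun a _ b _ => e.map_rel_iff
  refine ⟨e.toEquiv.nonempty, Finite.of_equiv W e.toEquiv.symm, ?_, fun x => ?_⟩
  · rw [← he, Set.image_univ_of_surjective e.surjective]
    exact h3
  · rw [← he, Set.image_compl_eq e.bijective, Set.image_singleton]
    exact h4 _

/-- The trace of an interval on a smaller set of vertices. -/
theorem IsIntervalIn.inter {T : Tournament V} {A B I : Set V} (h : T.IsIntervalIn A I)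
    (hBA : B ⊆ A) : T.IsIntervalIn B (I ∩ B) :=
  ⟨Set.inter_subset_right, fun y hy hyI x hx x' hx' =>
    h.2 y (hBA hy) (fun h => hyI ⟨h, hy⟩) x hx.1 x' hx'.1⟩

/-! ### Enlarging an indecomposable subtournament by two vertices -/

theorem exists_mem_ne_ne_of_three_le_ncard {X : Set V} (h : 3 ≤ X.ncard) (a b : V) :
    ∃ c ∈ X, c ≠ a ∧ c ≠ b := by
  have h2 : ({a, b} : Set V).ncard ≤ 2 := by
    refine (Set.ncard_insert_le _ _).trans ?_
    simp
  obtain ⟨c, hc, hc'⟩ := Set.exists_mem_notMem_of_ncard_lt_ncard (lt_of_le_of_lt h2 h)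
  simp only [Set.mem_insert_iff, Set.mem_singleton_iff, not_or] at hc'
  exact ⟨c, hc, hc'⟩

/-- `a` does not distinguish two vertices of `X`. -/
def Uniform (T : Tournament V) (a : V) (X : Set V) : Prop :=
  ∀ x ∈ X, ∀ x' ∈ X, (T.Adj a x ↔ T.Adj a x')

/-- No vertex of `X`, other than `u` and `v` themselves, distinguishes `u` and `v`. -/
def Twin (T : Tournament V) (X : Set V) (u v : V) : Prop :=
  ∀ x ∈ X, x ≠ u → x ≠ v → (T.Adj x u ↔ T.Adj x v)

theorem isIntervalIn_pair {T : Tournament V} {A : Set V} {u v : V} (hu : u ∈ A) (hv : v ∈ A)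
    (h : T.Twin A u v) : T.IsIntervalIn A {u, v} := by
  refine ⟨by rintro x (rfl | rfl) <;> assumption, ?_⟩
  intro y hy hyI
  simp only [Set.mem_insert_iff, Set.mem_singleton_iff, not_or] at hyI
  have := h y hy hyI.1 hyI.2
  rintro x (rfl | rfl) x' (rfl | rfl) <;> tauto

/-- An indecomposable set of at least three vertices has no two twins. -/
theorem IsIndecomposableOn.not_twin {T : Tournament V} {X : Set V} (hX : T.IsIndecomposableOn X)
    (h3 : 3 ≤ X.ncard) {u v : V} (hu : u ∈ X) (hv : v ∈ X) (huv : u ≠ v) : ¬ T.Twin X u v := by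
  intro h
  obtain ⟨c, hc, hcu, hcv⟩ := exists_mem_ne_ne_of_three_le_ncard h3 u v
  rcases hX _ (isIntervalIn_pair hu hv h) with h | h
  · exact huv (h (by simp) (by simp))
  · rcases h.symm ▸ hc with h | h
    · exact hcu h
    · exact hcv h

/-- In an indecomposable set of at least three vertices, every vertex distinguishes two others. -/
theorem IsIndecomposableOn.not_uniform {T : Tournament V} {X : Set V}
    (hX : T.IsIndecomposableOn X) (h3 : 3 ≤ X.ncard) {u : V} (hu : u ∈ X) :
    ¬ T.Uniform u (X \ {u}) := by
  intro h
  obtain ⟨c, hc, hcu, -⟩ := exists_mem_ne_ne_of_three_le_ncard h3 u u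
  obtain ⟨d, hd, hdu, hdc⟩ := exists_mem_ne_ne_of_three_le_ncard h3 u c
  have : T.IsIntervalIn X (X \ {u}) := by
    refine ⟨Set.sdiff_subset, fun y hy hyI => ?_⟩
    have : y = u := by
      by_contra hne
      exact hyI ⟨hy, hne⟩
    rw [this]
    exact h
  rcases hX _ this with h | h
  · exact hdc (h ⟨hd, hdu⟩ ⟨hc, hcu⟩)
  · rw [← h] at hu
    exact hu.2 rfl

/-- A vertex whose addition to an indecomposable set destroys indecomposability either fails to
distinguish the vertices of the set or is a twin of one of them. -/
theorem IsIndecomposableOn.uniform_or_twin {T : Tournament V} {X : Set V}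
    (hX : T.IsIndecomposableOn X) {a : V}
    (h : ¬ T.IsIndecomposableOn (insert a X)) : T.Uniform a X ∨ ∃ u ∈ X, T.Twin X u a := by
  simp only [IsIndecomposableOn, not_forall, not_or] at h
  obtain ⟨I, hI, hns, hne⟩ := h
  rcases hX _ (hI.inter (Set.subset_insert a X)) with h | h
  · right
    have haI : a ∈ I := by
      by_contra haI
      refine hns fun x hx y hy => h ⟨hx, ?_⟩ ⟨hy, ?_⟩
      · exact (hI.1 hx).resolve_left (ne_of_mem_of_not_mem hx haI)
      · exact (hI.1 hy).resolve_left (ne_of_mem_of_not_mem hy haI)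
    obtain ⟨u, hu, hua⟩ := (Set.not_subsingleton_iff.1 hns).exists_ne a
    have huX : u ∈ X := (hI.1 hu).resolve_left hua
    refine ⟨u, huX, fun x hx hxu _ => ?_⟩
    exact hI.2 x (Or.inr hx) (fun hxI => hxu (h ⟨hxI, hx⟩ ⟨hu, huX⟩)) u hu a haI
  · left
    have hXI : X ⊆ I := by
      rw [← h]
      exact Set.inter_subset_left
    have haI : a ∉ I := fun haI => hne (hI.1.antisymm (Set.insert_subset haI hXI))
    exact fun x hx x' hx' => hI.2 a (Or.inl rfl) haI x (hXI hx) x' (hXI hx')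

/-- If `X` is indecomposable, `a` does not distinguish the vertices of `X`, `b` does, and
`X ∪ {a, b}` is decomposable, then `a` does not distinguish the vertices of `X ∪ {b}`. -/
theorem IsIndecomposableOn.uniform_insert {T : Tournament V} {X : Set V}
    (hX : T.IsIndecomposableOn X) (h3 : 3 ≤ X.ncard) {a b : V}
    (hau : T.Uniform a X) (hbu : ¬ T.Uniform b X)
    (h : ¬ T.IsIndecomposableOn (insert a (insert b X))) : T.Uniform a (insert b X) := by
  simp only [IsIndecomposableOn, not_forall, not_or] at h
  obtain ⟨I, hI, hns, hne⟩ := h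
  have hXA : X ⊆ insert a (insert b X) := (Set.subset_insert b X).trans (Set.subset_insert a _)
  rcases hX _ (hI.inter hXA) with h | h
  · -- The interval meets `X` in at most one vertex, so it is a pair `{b, w}` with `w ∈ X`.
    have haI : a ∉ I := by
      intro haI
      by_cases hw : ∃ w ∈ I, w ∈ X
      · obtain ⟨w, hwI, hwX⟩ := hw
        refine hX.not_uniform h3 hwX fun x hx x' hx' => ?_
        have h1 : ∀ x ∈ X \ {w}, (T.Adj w x ↔ T.Adj a x) := by
          intro x hx
          have hxI : x ∉ I := fun hxI => hx.2 (h ⟨hxI, hx.1⟩ ⟨hwI, hwX⟩)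
          rw [T.adj_iff_not_adj (Ne.symm hx.2), T.adj_iff_not_adj (ne_of_mem_of_not_mem haI hxI),
            hI.2 x (hXA hx.1) hxI w hwI a haI]
        rw [h1 x hx, h1 x' hx', hau x hx.1 x' hx'.1]
      · push Not at hw
        have hbI : b ∈ I := by
          by_contra hbI
          refine hns fun x hx y hy => ?_
          have : ∀ x ∈ I, x = a := by
            intro x hx
            rcases hI.1 hx with h | h | h
            · exact h
            · rw [h] at hx
              exact absurd hx hbI
            · exact absurd h (hw x hx)
          rw [this x hx, this y hy]
        refine hbu fun x hx x' hx' => ?_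
        have h1 : ∀ x ∈ X, (T.Adj b x ↔ T.Adj a x) := by
          intro x hx
          have hxI : x ∉ I := fun hxI => hw x hxI hx
          rw [T.adj_iff_not_adj (ne_of_mem_of_not_mem hbI hxI),
            T.adj_iff_not_adj (ne_of_mem_of_not_mem haI hxI),
            hI.2 x (hXA hx) hxI b hbI a haI]
        rw [h1 x hx, h1 x' hx', hau x hx x' hx']
    obtain ⟨w, hw, hwb⟩ := (Set.not_subsingleton_iff.1 hns).exists_ne b
    have hwX : w ∈ X :=
      ((hI.1 hw).resolve_left (ne_of_mem_of_not_mem hw haI)).resolve_left hwb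
    have hbI : b ∈ I := by
      by_contra hbI
      refine hns fun x hx y hy => h ⟨hx, ?_⟩ ⟨hy, ?_⟩
      · exact ((hI.1 hx).resolve_left (ne_of_mem_of_not_mem hx haI)).resolve_left
          (ne_of_mem_of_not_mem hx hbI)
      · exact ((hI.1 hy).resolve_left (ne_of_mem_of_not_mem hy haI)).resolve_left
          (ne_of_mem_of_not_mem hy hbI)
    have h1 : ∀ x ∈ insert b X, (T.Adj a x ↔ T.Adj a w) := by
      rintro x (rfl | hx)
      · exact hI.2 a (Or.inl rfl) haI _ hbI _ hw
      · exact hau x hx w hwX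
    exact fun x hx x' hx' => (h1 x hx).trans (h1 x' hx').symm
  · have hXI : X ⊆ I := by
      rw [← h]
      exact Set.inter_subset_left
    have hbI : b ∈ I := by
      by_contra hbI
      exact hbu fun x hx x' hx' => hI.2 b (by simp) hbI x (hXI hx) x' (hXI hx')
    have haI : a ∉ I := fun haI =>
      hne (hI.1.antisymm (Set.insert_subset haI (Set.insert_subset hbI hXI)))
    have hbX : insert b X ⊆ I := Set.insert_subset hbI hXI
    exact fun x hx x' hx' => hI.2 a (Or.inl rfl) haI x (hbX hx) x' (hbX hx')

/-- If `X` is indecomposable, `a` is a twin of `u ∈ X` but `b` is not, `b` distinguishes two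
vertices of `X`, and `X ∪ {a, b}` is decomposable, then `b` does not distinguish `u` and `a`. -/
theorem IsIndecomposableOn.adj_iff_of_twin {T : Tournament V} {X : Set V}
    (hX : T.IsIndecomposableOn X) (h3 : 3 ≤ X.ncard) {a b u : V} (ha : a ∉ X) (hb : b ∉ X)
    (hab : a ≠ b) (hu : u ∈ X) (hau : T.Twin X u a) (hbu : ¬ T.Twin X u b)
    (hbX : ¬ T.Uniform b X) (h : ¬ T.IsIndecomposableOn (insert a (insert b X))) :
    T.Adj b u ↔ T.Adj b a := by
  simp only [IsIndecomposableOn, not_forall, not_or] at h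
  obtain ⟨I, hI, hns, hne⟩ := h
  have hXA : X ⊆ insert a (insert b X) := (Set.subset_insert b X).trans (Set.subset_insert a _)
  rcases hX _ (hI.inter hXA) with h | h
  · have twin : ∀ c ∈ I, ∀ w ∈ I, w ∈ X → T.Twin X w c := by
      intro c hc w hw hwX x hx hxw _
      exact hI.2 x (hXA hx) (fun hxI => hxw (h ⟨hxI, hx⟩ ⟨hw, hwX⟩)) w hw c hc
    -- Two vertices of `X` with the same twin coincide.
    have eq_of_twin : ∀ c, c ∉ X → ∀ w ∈ X, ∀ w' ∈ X, T.Twin X w c → T.Twin X w' c → w = w' := by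
      intro c hc w hw w' hw' h1 h2
      by_contra hww
      refine hX.not_twin h3 hw hw' hww fun x hx hxw hxw' => ?_
      have hxc := ne_of_mem_of_not_mem hx hc
      rw [h1 x hx hxw hxc, h2 x hx hxw' hxc]
    by_cases hw : ∃ w ∈ I, w ∈ X
    · obtain ⟨w, hwI, hwX⟩ := hw
      by_cases haI : a ∈ I
      · have hwu : w = u := eq_of_twin a ha w hwX u hu (twin a haI w hwI hwX) hau
        subst hwu
        have hbI : b ∉ I := fun hbI => hbu (twin b hbI w hwI hwX)
        exact hI.2 b (by simp) hbI w hwI a haI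
      · have hbI : b ∈ I := by
          by_contra hbI
          refine hns fun x hx y hy => h ⟨hx, ?_⟩ ⟨hy, ?_⟩
          · exact ((hI.1 hx).resolve_left (ne_of_mem_of_not_mem hx haI)).resolve_left
              (ne_of_mem_of_not_mem hx hbI)
          · exact ((hI.1 hy).resolve_left (ne_of_mem_of_not_mem hy haI)).resolve_left
              (ne_of_mem_of_not_mem hy hbI)
        have hwb := twin b hbI w hwI hwX
        have hwu : w ≠ u := by
          rintro rfl
          exact hbu hwb
        -- `b` inherits its arcs from `w`, which does not distinguish `u` and `a`.
        have hub : u ≠ b := ne_of_mem_of_not_mem hu hb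
        have h1 := hwb u hu hwu.symm hub
        have h2 := hau w hwX hwu (ne_of_mem_of_not_mem hwX ha)
        have h3 := hI.2 a (Or.inl rfl) haI w hwI b hbI
        rw [T.adj_iff_not_adj hub.symm, ← h1, ← T.adj_iff_not_adj hwu, h2,
          T.adj_iff_not_adj (ne_of_mem_of_not_mem hwX ha), h3, ← T.adj_iff_not_adj hab.symm]
    · push Not at hw
      have hIab : ∀ x ∈ I, x = a ∨ x = b := fun x hx => by
        rcases hI.1 hx with h | h | h
        · exact Or.inl h
        · exact Or.inr h
        · exact absurd h (hw x hx)
      have habI : a ∈ I ∧ b ∈ I := by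
        obtain ⟨x, hx, hxa⟩ := (Set.not_subsingleton_iff.1 hns).exists_ne a
        obtain ⟨y, hy, hyb⟩ := (Set.not_subsingleton_iff.1 hns).exists_ne b
        have := (hIab x hx).resolve_left hxa
        have := (hIab y hy).resolve_right hyb
        subst x y
        exact ⟨hy, hx⟩
      refine absurd (fun x hx hxu hxb => ?_) hbu
      rw [hau x hx hxu (ne_of_mem_of_not_mem hx ha)]
      exact hI.2 x (hXA hx) (fun h => hw x h hx) a habI.1 b habI.2
  · have hXI : X ⊆ I := by
      rw [← h]
      exact Set.inter_subset_left
    have hbI : b ∈ I := by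
      by_contra hbI
      exact hbX fun x hx x' hx' => hI.2 b (by simp) hbI x (hXI hx) x' (hXI hx')
    have haI : a ∉ I := fun haI =>
      hne (hI.1.antisymm (Set.insert_subset haI (Set.insert_subset hbI hXI)))
    -- Otherwise `u` would inherit uniformity on `X` from its twin `a`.
    refine absurd (fun x hx x' hx' => ?_) (hX.not_uniform h3 hu)
    have h1 : ∀ x ∈ X \ {u}, (T.Adj u x ↔ T.Adj a x) := by
      intro x hx
      rw [T.adj_iff_not_adj (Ne.symm hx.2),
        T.adj_iff_not_adj (ne_of_mem_of_not_mem hx.1 ha).symm,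
        hau x hx.1 hx.2 (ne_of_mem_of_not_mem hx.1 ha)]
    rw [h1 x hx, h1 x' hx', hI.2 a (Or.inl rfl) haI x (hXI hx.1) x' (hXI hx'.1)]

/-- The Ehrenfeucht–Rozenberg extension theorem, for a set which no single vertex enlarges to an
indecomposable set: some two vertices do. -/
theorem IsIndecomposableOn.exists_insert_insert {T : Tournament V} {X : Set V}
    (hX : T.IsIndecomposableOn X) (hT : T.IsIndecomposableOn Set.univ) (h3 : 3 ≤ X.ncard)
    (hXne : X ≠ Set.univ) (hext : ∀ a, a ∉ X → ¬ T.IsIndecomposableOn (insert a X)) :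
    ∃ a b, a ∉ X ∧ b ∉ X ∧ a ≠ b ∧ T.IsIndecomposableOn (insert a (insert b X)) := by
  by_contra! hcon
  have twin_notUniform : ∀ u ∈ X, ∀ a, a ∉ X → T.Twin X u a → ¬ T.Uniform a X := by
    intro u hu a ha hau hun
    refine hX.not_uniform h3 hu fun x hx x' hx' => ?_
    have h1 : ∀ x ∈ X \ {u}, (T.Adj u x ↔ T.Adj a x) := by
      intro x hx
      rw [T.adj_iff_not_adj (Ne.symm hx.2),
        T.adj_iff_not_adj (ne_of_mem_of_not_mem hx.1 ha).symm,
        hau x hx.1 hx.2 (ne_of_mem_of_not_mem hx.1 ha)]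
    rw [h1 x hx, h1 x' hx', hun x hx.1 x' hx'.1]
  obtain ⟨c, hc⟩ : X.Nonempty := Set.nonempty_of_ncard_ne_zero (by omega)
  obtain ⟨d, hd, hdc, -⟩ := exists_mem_ne_ne_of_three_le_ncard h3 c c
  by_cases hU : ∃ a, a ∉ X ∧ T.Uniform a X
  · -- The vertices outside `X` that do not distinguish its vertices have an interval as complement.
    obtain ⟨a, haX, ha⟩ := hU
    have : T.IsIntervalIn Set.univ {v | v ∉ X → ¬ T.Uniform v X} := by
      refine ⟨Set.subset_univ _, fun y _ hy => ?_⟩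
      simp only [Set.mem_ofPred_eq, not_forall, not_not] at hy
      obtain ⟨hyX, hy⟩ := hy
      have h1 : ∀ x, (x ∉ X → ¬ T.Uniform x X) → (T.Adj y x ↔ T.Adj y c) := by
        intro x hx
        by_cases hxX : x ∈ X
        · exact hy x hxX c hc
        · have hyx : y ≠ x := by
            rintro rfl
            exact hx hxX hy
          exact hX.uniform_insert h3 hy (hx hxX) (hcon y x hyX hxX hyx) x (Or.inl rfl) c
            (Or.inr hc)
      exact fun x hx x' hx' => (h1 x hx).trans (h1 x' hx').symm
    rcases hT _ this with h | h
    · exact hdc (h (fun h => absurd hd h) (fun h => absurd hc h))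
    · have : a ∈ {v | v ∉ X → ¬ T.Uniform v X} := by
        rw [h]
        trivial
      exact this haX ha
  · push Not at hU
    obtain ⟨a, ha⟩ := (Set.ne_univ_iff_exists_notMem X).1 hXne
    obtain ⟨u, hu, hua⟩ := (hX.uniform_or_twin (hext a ha)).resolve_left (hU a ha)
    -- A vertex of `X` and its outer twins form an interval.
    have : T.IsIntervalIn Set.univ {v | v = u ∨ v ∉ X ∧ T.Twin X u v} := by
      refine ⟨Set.subset_univ _, fun y _ hy => ?_⟩
      simp only [Set.mem_ofPred_eq, not_or, not_and] at hy
      obtain ⟨hyu, hy⟩ := hy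
      have h1 : ∀ x, (x = u ∨ x ∉ X ∧ T.Twin X u x) → (T.Adj y u ↔ T.Adj y x) := by
        rintro x (rfl | ⟨hxX, hx⟩)
        · rfl
        · by_cases hyX : y ∈ X
          · exact hx y hyX hyu (ne_of_mem_of_not_mem hyX hxX)
          · have hxy : x ≠ y := by
              rintro rfl
              exact hy hxX hx
            exact hX.adj_iff_of_twin h3 hxX hyX hxy hu hx (hy hyX) (hU y hyX)
              (hcon x y hxX hyX hxy)
      exact fun x hx x' hx' => (h1 x hx).symm.trans (h1 x' hx')
    rcases hT _ this with h | h
    · exact ha (h (Or.inl rfl) (Or.inr ⟨ha, hua⟩) ▸ hu)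
    · obtain ⟨e, he, heu, -⟩ := exists_mem_ne_ne_of_three_le_ncard h3 u u
      have : e ∈ {v | v = u ∨ v ∉ X ∧ T.Twin X u v} := by
        rw [h]
        trivial
      rcases this with h | h
      · exact heu h
      · exact h.1 he

/-! ### The indecomposability graph of a critical tournament -/

theorem isIndecomposableOn_of_cycle {T : Tournament V} {x y z : V} (hxy : T.Adj x y)
    (hyz : T.Adj y z) (hzx : T.Adj z x) : T.IsIndecomposableOn {x, y, z} := by
  have nxy := (T.adj_iff_not_adj (ne_of_adj hxy)).1 hxy
  have nyz := (T.adj_iff_not_adj (ne_of_adj hyz)).1 hyz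
  have nzx := (T.adj_iff_not_adj (ne_of_adj hzx)).1 hzx
  rintro I ⟨hI, h⟩
  have h1 : z ∉ I → x ∈ I → y ∉ I := fun hz hx hy => nyz ((h z (by simp) hz x hx y hy).1 hzx)
  have h2 : y ∉ I → x ∈ I → z ∉ I := fun hy hx hz => nxy ((h y (by simp) hy z hz x hx).1 hyz)
  have h3 : x ∉ I → y ∈ I → z ∉ I := fun hx hy hz => nzx ((h x (by simp) hx y hy z hz).1 hxy)
  by_cases hall : x ∈ I ∧ y ∈ I ∧ z ∈ I
  · right
    refine hI.antisymm ?_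
    rintro w (rfl | rfl | rfl)
    exacts [hall.1, hall.2.1, hall.2.2]
  · left
    intro u hu v hv
    have hu' := hI hu
    have hv' := hI hv
    simp only [Set.mem_insert_iff, Set.mem_singleton_iff] at hu' hv'
    rcases hu' with rfl | rfl | rfl <;> rcases hv' with rfl | rfl | rfl <;> first | rfl | tauto

/-- If no `3`-cycle passes through `v`, then every in-neighbour of `v` dominates every
out-neighbour, which yields a nontrivial interval. -/
theorem IsIndecomposableOn.exists_cycle {T : Tournament V} (hT : T.IsIndecomposableOn Set.univ)
    {v a b : V} (hva : v ≠ a) (hvb : v ≠ b) (hab : a ≠ b) :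
    ∃ x y z, T.Adj x y ∧ T.Adj y z ∧ T.Adj z x := by
  by_contra! hcon
  have key : ∀ x y, T.Adj x v → T.Adj v y → T.Adj x y := by
    intro x y hx hy
    have hxy : x ≠ y := by
      rintro rfl
      exact (T.adj_iff_not_adj (ne_of_adj hx)).1 hx hy
    by_contra h
    rw [T.adj_iff_not_adj hxy, not_not] at h
    exact hcon x v y hx hy h
  by_cases hin : ∃ x, T.Adj x v
  · obtain ⟨x, hx⟩ := hin
    by_cases hout : ∃ y, T.Adj v y
    · obtain ⟨y, hy⟩ := hout
      have : T.IsIntervalIn Set.univ {w | w = v ∨ T.Adj v w} := by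
        refine ⟨Set.subset_univ _, fun u _ hu => ?_⟩
        simp only [Set.mem_ofPred_eq, not_or] at hu
        have huv : T.Adj u v := (T.adj_iff_not_adj hu.1).2 hu.2
        have h1 : ∀ w, (w = v ∨ T.Adj v w) → T.Adj u w := by
          rintro w (rfl | hw)
          exacts [huv, key u w huv hw]
        exact fun w hw w' hw' => iff_of_true (h1 w hw) (h1 w' hw')
      rcases hT _ this with h | h
      · exact T.loopless v ((h (Or.inr hy) (Or.inl rfl) : y = v) ▸ hy)
      · have hx' : x ∈ {w | w = v ∨ T.Adj v w} := h ▸ Set.mem_univ x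
        exact (T.adj_iff_not_adj (ne_of_adj hx)).1 hx (hx'.resolve_left (ne_of_adj hx))
    · push Not at hout
      have : T.IsIntervalIn Set.univ {v}ᶜ := by
        refine ⟨Set.subset_univ _, fun u _ hu w _ w' _ => ?_⟩
        rw [Set.notMem_compl_iff, Set.mem_singleton_iff] at hu
        subst hu
        exact iff_of_false (hout w) (hout w')
      rcases hT _ this with h | h
      · exact hab (h hva.symm hvb.symm)
      · exact (h.symm ▸ Set.mem_univ v : v ∈ ({v}ᶜ : Set V)) rfl
  · push Not at hin
    have : T.IsIntervalIn Set.univ {v}ᶜ := by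
      refine ⟨Set.subset_univ _, fun u _ hu w hw w' hw' => ?_⟩
      rw [Set.notMem_compl_iff, Set.mem_singleton_iff] at hu
      subst hu
      exact iff_of_true ((T.adj_iff_not_adj (Ne.symm hw)).2 (hin w))
        ((T.adj_iff_not_adj (Ne.symm hw')).2 (hin w'))
    rcases hT _ this with h | h
    · exact hab (h hva.symm hvb.symm)
    · exact (h.symm ▸ Set.mem_univ v : v ∈ ({v}ᶜ : Set V)) rfl

/-- Adjacency in the indecomposability graph of `T`: deleting both vertices leaves an
indecomposable tournament. -/
def Linked (T : Tournament V) (x y : V) : Prop :=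
  x ≠ y ∧ T.IsIndecomposableOn {x, y}ᶜ

theorem Linked.symm {T : Tournament V} {x y : V} (h : T.Linked x y) : T.Linked y x :=
  ⟨h.1.symm, Set.pair_comm x y ▸ h.2⟩

/-- A maximal proper indecomposable set of at least three vertices misses exactly two vertices. -/
theorem IsCritical.exists_linked {T : Tournament V} (hT : T.IsCritical) :
    ∃ a b, T.Linked a b ∧ 3 ≤ ({a, b}ᶜ : Set V).ncard := by
  obtain ⟨⟨v⟩, hfin, hind, hdel⟩ := (isCritical_iff T).1 hT
  have hv := hdel v
  simp only [IsIndecomposableOn, not_forall, not_or] at hv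
  obtain ⟨I, hI, hns, hne⟩ := hv
  obtain ⟨a, ha, b, hb, hab⟩ := Set.not_subsingleton_iff.1 hns
  obtain ⟨d, hd, hdI⟩ := Set.exists_of_ssubset (hI.1.ssubset_of_ne hne)
  obtain ⟨x, y, z, hxy, hyz, hzx⟩ := hind.exists_cycle (Ne.symm (hI.1 ha)) (Ne.symm (hI.1 hb)) hab
  have hcard : ({x, y, z} : Set V).ncard = 3 :=
    Set.ncard_eq_three.2 ⟨x, y, z, ne_of_adj hxy, (ne_of_adj hzx).symm, ne_of_adj hyz, rfl⟩
  have hcyc : ({x, y, z} : Set V) ≠ Set.univ := by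
    intro h
    have h4 : ({v, a, b, d} : Set V).ncard = 4 := by
      have := hI.1 ha
      have := hI.1 hb
      have := ne_of_mem_of_not_mem ha hdI
      have := ne_of_mem_of_not_mem hb hdI
      rw [Set.ncard_insert_of_notMem, Set.ncard_insert_of_notMem, Set.ncard_pair] <;>
        simp_all [eq_comm]
    have := Set.ncard_le_ncard (Set.subset_univ ({v, a, b, d} : Set V))
    rw [← h] at this
    omega
  obtain ⟨X, hX⟩ := (Set.toFinite {X : Set V | T.IsIndecomposableOn X ∧ 3 ≤ X.ncard ∧
    X ≠ Set.univ}).exists_maximal ⟨_, isIndecomposableOn_of_cycle hxy hyz hzx, hcard.ge, hcyc⟩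
  obtain ⟨hX1, hX2, hX3⟩ := hX.prop
  have hmax : ∀ Y, X ⊂ Y → T.IsIndecomposableOn Y → Y = Set.univ := by
    intro Y hXY hY
    by_contra hYne
    exact hXY.2 (hX.le_of_ge ⟨hY, hX2.trans (Set.ncard_le_ncard hXY.1), hYne⟩ hXY.1)
  have hext : ∀ a, a ∉ X → ¬ T.IsIndecomposableOn (insert a X) := by
    intro a ha h
    have h1 := hmax _ (Set.ssubset_insert ha) h
    have h2 : X = {a}ᶜ := by
      ext w
      have : w ∈ insert a X := h1 ▸ Set.mem_univ w
      refine ⟨fun hw => ne_of_mem_of_not_mem hw ha, fun hw => this.resolve_left hw⟩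
    exact hdel a (h2 ▸ hX1)
  obtain ⟨a, b, ha, hb, hab, h⟩ := hX1.exists_insert_insert hind hX2 hX3 hext
  have h1 := hmax _ ((Set.ssubset_insert hb).trans_subset (Set.subset_insert a _)) h
  have h2 : X = {a, b}ᶜ := by
    ext w
    have : w ∈ insert a (insert b X) := h1 ▸ Set.mem_univ w
    constructor
    · rintro hw (rfl | rfl)
      exacts [ha hw, hb hw]
    · rw [Set.mem_compl_iff, Set.mem_insert_iff, Set.mem_singleton_iff, not_or]
      exact fun hw => (this.resolve_left hw.1).resolve_left hw.2
  exact ⟨a, b, ⟨hab, h2 ▸ hX1⟩, h2 ▸ hX2⟩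

theorem IsCritical.exists_ne {T : Tournament V} (hT : T.IsCritical) (a b c d : V) :
    ∃ v, v ≠ a ∧ v ≠ b ∧ v ≠ c ∧ v ≠ d := by
  have := hT.2.1
  obtain ⟨x, y, hxy, h3⟩ := hT.exists_linked
  have h1 := Set.ncard_add_ncard_compl ({x, y} : Set V)
  rw [Set.ncard_pair hxy.1] at h1
  have h2 : ({a, b, c, d} : Set V).ncard < (Set.univ : Set V).ncard := by
    rw [Set.ncard_univ]
    have := Set.ncard_insert_le a ({b, c, d} : Set V)
    have := Set.ncard_insert_le b ({c, d} : Set V)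
    have := Set.ncard_insert_le c ({d} : Set V)
    rw [Set.ncard_singleton] at this
    omega
  obtain ⟨v, -, hv⟩ := Set.exists_mem_notMem_of_ncard_lt_ncard h2
  simp only [Set.mem_insert_iff, Set.mem_singleton_iff, not_or] at hv
  exact ⟨v, hv⟩

/-- In a critical tournament, if `x` is linked to `y`, then either `y` does not distinguish the
vertices of `T - {x, y}`, or `y` has a twin in `T - x`, which is then linked to `x` too. -/
theorem IsCritical.uniform_or_linked {T : Tournament V} (hT : T.IsCritical) {x y : V}
    (h : T.Linked x y) :
    T.Uniform y {x, y}ᶜ ∨ ∃ z, z ≠ y ∧ T.Linked x z ∧ T.Twin {x}ᶜ y z := by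
  obtain ⟨-, -, -, hdel⟩ := (isCritical_iff T).1 hT
  have hx : ({x}ᶜ : Set V) = insert y {x, y}ᶜ := by
    ext w
    by_cases hw : w = y
    · simp [hw, h.1.symm]
    · simp [hw]
  have hd := hdel x
  rw [hx] at hd
  refine (h.2.uniform_or_twin hd).imp_right ?_
  rintro ⟨z, hz, htw⟩
  rw [Set.mem_compl_iff, Set.mem_insert_iff, Set.mem_singleton_iff, not_or] at hz
  have htw' : ∀ w, w ≠ x → w ≠ y → w ≠ z → (T.Adj w y ↔ T.Adj w z) := fun w hwx hwy hwz =>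
    (htw w (by simp [hwx, hwy]) hwz hwy).symm
  refine ⟨z, hz.2, ⟨Ne.symm hz.1, ?_⟩, fun w hw hwy hwz => htw' w hw hwy hwz⟩
  -- Exchanging the twins `y` and `z` is an isomorphism between `T - {x, z}` and `T - {x, y}`.
  classical
  have himg : Equiv.swap y z '' {x, z}ᶜ = {x, y}ᶜ := by
    rw [Set.image_compl_eq (Equiv.swap y z).bijective, Set.image_pair, Equiv.swap_apply_right,
      Equiv.swap_apply_of_ne_of_ne h.1 (Ne.symm hz.1)]
  have h2 := h.2
  rw [← himg, isIndecomposableOn_image] at h2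
  · exact h2
  · intro a ha b hb
    simp only [Set.mem_compl_iff, Set.mem_insert_iff, Set.mem_singleton_iff, not_or] at ha hb
    by_cases hay : a = y <;> by_cases hby : b = y
    · subst hay hby
      exact iff_of_false (T.loopless _) (T.loopless _)
    · subst hay
      rw [Equiv.swap_apply_left, Equiv.swap_apply_of_ne_of_ne hby hb.2,
        T.adj_iff_not_adj (Ne.symm hb.2), T.adj_iff_not_adj (Ne.symm hby),
        htw' b hb.1 hby hb.2]
    · subst hby
      rw [Equiv.swap_apply_left, Equiv.swap_apply_of_ne_of_ne hay ha.2, htw' a ha.1 hay ha.2]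
    · rw [Equiv.swap_apply_of_ne_of_ne hay ha.2, Equiv.swap_apply_of_ne_of_ne hby hb.2]

/-- If `y` does not distinguish the vertices of `T - {x, y}`, then `x` is linked to no vertex but
`y`. -/
theorem IsCritical.eq_of_uniform {T : Tournament V} (hT : T.IsCritical) {x y w : V} (hxy : x ≠ y)
    (h : T.Uniform y {x, y}ᶜ) (hw : T.Linked x w) : w = y := by
  by_contra hne
  have : T.IsIntervalIn {x, w}ᶜ {x, w, y}ᶜ := by
    refine ⟨Set.compl_subset_compl.2 (by intro; simp; tauto), fun u hu huI => ?_⟩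
    have : u = y := by
      simp only [Set.mem_compl_iff, Set.mem_insert_iff, Set.mem_singleton_iff] at hu huI
      tauto
    subst this
    intro a ha b hb
    simp only [Set.mem_compl_iff, Set.mem_insert_iff, Set.mem_singleton_iff] at ha hb
    exact h a (by simp; tauto) b (by simp; tauto)
  rcases hw.2 _ this with hs | hs
  · obtain ⟨a, ha⟩ := hT.exists_ne x w y y
    obtain ⟨b, hb⟩ := hT.exists_ne x w y a
    exact hb.2.2.2 (hs (by simp; tauto) (by simp; tauto))
  · have : y ∈ ({x, w, y}ᶜ : Set V) := by
      rw [hs]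
      simp [hxy.symm, Ne.symm hne]
    simp at this

/-- If `y` and `z` are twins in `T - x`, then `x` is linked to no vertex but `y` and `z`. -/
theorem IsCritical.eq_or_eq_of_twin {T : Tournament V} (hT : T.IsCritical) {x y z w : V}
    (hxy : x ≠ y) (hxz : x ≠ z) (hyz : y ≠ z) (h : T.Twin {x}ᶜ y z) (hw : T.Linked x w) :
    w = y ∨ w = z := by
  by_contra! hne
  have : T.IsIntervalIn {x, w}ᶜ {y, z} := by
    refine isIntervalIn_pair (by simp; tauto) (by simp; tauto) fun u hu huy huz => ?_
    exact h u (fun e => hu (by simp_all)) huy huz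
  rcases hw.2 _ this with hs | hs
  · exact hyz (hs (by simp) (by simp))
  · obtain ⟨a, ha⟩ := hT.exists_ne x w y z
    have : a ∈ ({x, w}ᶜ : Set V) := by simp; tauto
    rw [← hs] at this
    simp at this
    tauto

theorem IsCritical.uniform_or_exists_linked {T : Tournament V} (hT : T.IsCritical) {x y : V}
    (h : T.Linked x y) : T.Uniform y {x, y}ᶜ ∨ ∃ z, z ≠ y ∧ T.Linked x z :=
  (hT.uniform_or_linked h).imp_right fun ⟨z, hz, hxz, _⟩ => ⟨z, hz, hxz⟩

theorem IsCritical.twin_of_linked {T : Tournament V} (hT : T.IsCritical) {x y z : V}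
    (hy : T.Linked x y) (hz : T.Linked x z) (hyz : y ≠ z) : T.Twin {x}ᶜ y z := by
  rcases hT.uniform_or_linked hy with h | ⟨z', hz', hxz', htw⟩
  · exact absurd (hT.eq_of_uniform hy.1 h hz) hyz.symm
  · rcases hT.eq_or_eq_of_twin hy.1 hxz'.1 hz'.symm htw hz with h | h
    · exact absurd h hyz.symm
    · rwa [h]

/-- The indecomposability graph of a critical tournament has maximum degree at most two. -/
theorem IsCritical.eq_of_linked {T : Tournament V} (hT : T.IsCritical) {x y z w : V}
    (hy : T.Linked x y) (hz : T.Linked x z) (hyz : y ≠ z) (hw : T.Linked x w) : w = y ∨ w = z :=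
  hT.eq_or_eq_of_twin hy.1 hz.1 hyz (hT.twin_of_linked hy hz hyz) hw

/-- Two vertices linked to `x` are distinguished by `x`, since otherwise they would form an
interval. -/
theorem IsCritical.adj_iff_of_linked {T : Tournament V} (hT : T.IsCritical) {x y z : V}
    (hy : T.Linked x y) (hz : T.Linked x z) (hyz : y ≠ z) : T.Adj y x ↔ T.Adj x z := by
  obtain ⟨-, -, hind, -⟩ := (isCritical_iff T).1 hT
  rw [T.adj_iff_not_adj hy.1.symm]
  by_contra hcon
  have hxyz : T.Adj x y ↔ T.Adj x z := by tauto
  have htw := hT.twin_of_linked hy hz hyz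
  have : T.IsIntervalIn Set.univ {y, z} := by
    refine isIntervalIn_pair trivial trivial fun u _ huy huz => ?_
    by_cases hux : u = x
    · rwa [hux]
    · exact htw u hux huy huz
  rcases hind _ this with h | h
  · exact hyz (h (by simp) (by simp))
  · have : x ∈ ({y, z} : Set V) := h ▸ Set.mem_univ x
    rcases this with h | h
    · exact hy.1 h
    · exact hz.1 h

/-! ### Longest paths of the indecomposability graph -/

/-- `x 0, …, x k` is a path of the indecomposability graph of `T`; the values of `x` beyond `k`
play no role. -/
structure IsLinkedPath (T : Tournament V) (x : ℕ → V) (k : ℕ) : Prop where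
  inj : ∀ i ≤ k, ∀ j ≤ k, x i = x j → i = j
  linked : ∀ i < k, T.Linked (x i) (x (i + 1))

theorem IsLinkedPath.reverse {T : Tournament V} {x : ℕ → V} {k : ℕ} (h : T.IsLinkedPath x k) :
    T.IsLinkedPath (fun i => x (k - i)) k where
  inj i hi j hj hij := by
    have := h.inj (k - i) (by omega) (k - j) (by omega) hij
    omega
  linked i hi := by
    have := (h.linked (k - (i + 1)) (by omega)).symm
    rwa [show k - (i + 1) + 1 = k - i by omega] at this

theorem IsCritical.exists_longest_path {T : Tournament V} (hT : T.IsCritical) :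
    ∃ x k, 1 ≤ k ∧ T.IsLinkedPath x k ∧ ∀ y m, T.IsLinkedPath y m → m ≤ k := by
  classical
  have := hT.2.1
  obtain ⟨a, b, hab, -⟩ := hT.exists_linked
  have hbound : ∀ y m, T.IsLinkedPath y m → m ≤ Nat.card V := by
    intro y m h
    have := Nat.card_le_card_of_injective (fun i : Fin (m + 1) => y i) fun i j hij =>
      Fin.ext (h.inj i (by omega) j (by omega) hij)
    rw [Nat.card_fin] at this
    omega
  have h1 : T.IsLinkedPath (fun i => if i = 0 then a else b) 1 := by
    refine ⟨fun i hi j hj hij => ?_, fun i hi => ?_⟩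
    · interval_cases i <;> interval_cases j <;> simp_all [hab.1, hab.1.symm]
    · interval_cases i
      simpa using hab
  have hex : ∃ x, T.IsLinkedPath x 1 := ⟨_, h1⟩
  obtain ⟨x, hx⟩ := Nat.findGreatest_spec (P := fun k => ∃ x, T.IsLinkedPath x k)
    (hbound _ _ h1) hex
  exact ⟨x, _, Nat.le_findGreatest (hbound _ _ h1) hex, hx, fun y m h =>
    Nat.le_findGreatest (hbound _ _ h) ⟨y, h⟩⟩

/-- A longest path either closes up to a cycle or ends in a vertex with a single neighbour. -/
theorem IsCritical.uniform_or_linked_ends {T : Tournament V} (hT : T.IsCritical) {x : ℕ → V}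
    {k : ℕ} (hk : 1 ≤ k) (hx : T.IsLinkedPath x k)
    (hmax : ∀ y m, T.IsLinkedPath y m → m ≤ k) :
    T.Uniform (x (k - 1)) {x k, x (k - 1)}ᶜ ∨ 2 ≤ k ∧ T.Linked (x 0) (x k) := by
  have hlast : T.Linked (x k) (x (k - 1)) := by
    have := (hx.linked (k - 1) (by omega)).symm
    rwa [show k - 1 + 1 = k by omega] at this
  refine (hT.uniform_or_exists_linked hlast).imp_right ?_
  rintro ⟨z, hz, hkz⟩
  have hzx : ∃ j ≤ k, x j = z := by
    by_contra! hcon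
    have : T.IsLinkedPath (Function.update x (k + 1) z) (k + 1) := by
      refine ⟨fun i hi j hj hij => ?_, fun i hi => ?_⟩
      · by_cases hi' : i = k + 1 <;> by_cases hj' : j = k + 1
        · omega
        · subst hi'
          rw [Function.update_self, Function.update_of_ne hj'] at hij
          exact absurd hij.symm (hcon j (by omega))
        · subst hj'
          rw [Function.update_self, Function.update_of_ne hi'] at hij
          exact absurd hij (hcon i (by omega))
        · rw [Function.update_of_ne hi', Function.update_of_ne hj'] at hij
          exact hx.inj i (by omega) j (by omega) hij
      · rw [Function.update_of_ne (show i ≠ k + 1 by omega)]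
        by_cases hi' : i = k
        · subst hi'
          rwa [Function.update_self]
        · rw [Function.update_of_ne (show i + 1 ≠ k + 1 by omega)]
          exact hx.linked i (by omega)
    have := hmax _ _ this
    omega
  obtain ⟨j, hj, rfl⟩ := hzx
  have hj1 : j ≠ k - 1 := fun e => hz (by rw [e])
  have hj2 : j ≠ k := fun e => hkz.1 (by rw [e])
  have hj0 : j = 0 := by
    -- An inner vertex of the path already has two neighbours, neither of which is `x k`.
    by_contra hj0
    have h1 := (hx.linked (j - 1) (by omega)).symm
    rw [show j - 1 + 1 = j by omega] at h1
    have h2 := hx.linked j (by omega)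
    rcases hT.eq_of_linked h1 h2 (fun e => by
      have := hx.inj _ (by omega) _ (by omega) e
      omega) hkz.symm with h | h
    · have := hx.inj _ (by omega) _ (by omega) h
      omega
    · have := hx.inj _ (by omega) _ (by omega) h
      omega
  subst hj0
  exact ⟨by omega, hkz.symm⟩

/-! ### Arcs along a path of the indecomposability graph -/

theorem IsLinkedPath.twin {T : Tournament V} (hT : T.IsCritical) {x : ℕ → V} {k : ℕ}
    (hx : T.IsLinkedPath x k) {i : ℕ} (hi : i + 2 ≤ k) :
    T.Twin {x (i + 1)}ᶜ (x i) (x (i + 2)) := by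
  refine hT.twin_of_linked (hx.linked i (by omega)).symm (hx.linked (i + 1) (by omega)) fun e => ?_
  have := hx.inj _ (by omega) _ (by omega) e
  omega

theorem IsLinkedPath.adj_iff_adj_add_two {T : Tournament V} (hT : T.IsCritical) {x : ℕ → V}
    {k : ℕ} (hx : T.IsLinkedPath x k) {i j : ℕ} (hi : i + 2 ≤ k) (hj : j ≤ k) (h0 : j ≠ i)
    (h1 : j ≠ i + 1) (h2 : j ≠ i + 2) : T.Adj (x j) (x i) ↔ T.Adj (x j) (x (i + 2)) :=
  hx.twin hT hi _ (fun e => h1 (hx.inj _ hj _ (by omega) e))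
    (fun e => h0 (hx.inj _ hj _ (by omega) e)) (fun e => h2 (hx.inj _ hj _ (by omega) e))

theorem IsLinkedPath.adj_succ_iff {T : Tournament V} (hT : T.IsCritical) {x : ℕ → V} {k : ℕ}
    (hx : T.IsLinkedPath x k) {i : ℕ} (hi : i < k) :
    T.Adj (x i) (x (i + 1)) ↔ T.Adj (x 0) (x 1) := by
  induction i with
  | zero => rfl
  | succ i ih =>
    rw [← ih (by omega), hT.adj_iff_of_linked (hx.linked i (by omega)).symm (hx.linked (i + 1) hi)]
    intro e
    have := hx.inj _ (by omega) _ (by omega) e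
    omega

/-- If the path is oriented along its first arc, then so are all arcs between vertices whose
positions have different parities. -/
theorem IsLinkedPath.adj_of_odd {T : Tournament V} (hT : T.IsCritical) {x : ℕ → V} {k : ℕ}
    (hx : T.IsLinkedPath x k) (h01 : T.Adj (x 0) (x 1)) {i j : ℕ} (hij : i < j) (hj : j ≤ k)
    (hpar : i % 2 ≠ j % 2) : T.Adj (x i) (x j) := by
  obtain ⟨d, rfl⟩ : ∃ d, j = i + 2 * d + 1 := ⟨(j - i) / 2, by omega⟩
  clear hij hpar
  induction d with
  | zero => exact (hx.adj_succ_iff hT hj).2 h01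
  | succ d ih =>
    exact (hx.adj_iff_adj_add_two hT (i := i + 2 * d + 1) hj (by omega) (by omega) (by omega)
      (by omega)).1 (ih (by omega))

/-- The arcs between vertices whose positions are even are all oriented along the path, or all
oriented against it, and likewise for odd positions. -/
theorem IsLinkedPath.adj_iff_of_even {T : Tournament V} (hT : T.IsCritical) {x : ℕ → V} {k : ℕ}
    (hx : T.IsLinkedPath x k) {i j : ℕ} (hij : i < j) (hj : j ≤ k) (hpar : i % 2 = j % 2) :
    T.Adj (x i) (x j) ↔ T.Adj (x (i % 2)) (x (i % 2 + 2)) := by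
  have h1 : ∀ i d, i + 2 * (d + 1) ≤ k →
      (T.Adj (x i) (x (i + 2 * (d + 1))) ↔ T.Adj (x i) (x (i + 2))) := by
    intro i d
    induction d with
    | zero => exact fun _ => Iff.rfl
    | succ d ih =>
      intro h
      rw [← ih (by omega)]
      exact (hx.adj_iff_adj_add_two hT (i := i + 2 * (d + 1)) h (by omega) (by omega) (by omega)
        (by omega)).symm
  have h2 : ∀ r m, r + 2 * m + 2 ≤ k →
      (T.Adj (x (r + 2 * m)) (x (r + 2 * m + 2)) ↔ T.Adj (x r) (x (r + 2))) := by
    intro r m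
    induction m with
    | zero => exact fun _ => Iff.rfl
    | succ m ih =>
      intro h
      have hne : ∀ a b, a ≤ k → b ≤ k → a ≠ b → x a ≠ x b :=
        fun a b ha hb hab e => hab (hx.inj _ ha _ hb e)
      have h3 := hx.adj_iff_adj_add_two hT (i := r + 2 * m) (j := r + 2 * (m + 1) + 2)
        (by omega) (by omega) (by omega) (by omega) (by omega)
      have h4 := h1 (r + 2 * m) 1 (by omega)
      rw [← ih (by omega), ← h4, T.adj_iff_not_adj (hne _ _ (by omega) (by omega) (by omega)),
        T.adj_iff_not_adj (x := x (r + 2 * m)) (hne _ _ (by omega) (by omega) (by omega))]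
      exact not_congr h3.symm
  obtain ⟨d, rfl⟩ : ∃ d, j = i + 2 * (d + 1) := ⟨(j - i) / 2 - 1, by omega⟩
  rw [h1 i d hj]
  have := h2 (i % 2) (i / 2) (by omega)
  rwa [show i % 2 + 2 * (i / 2) = i by omega] at this

/-- A vertex off the path does not distinguish path vertices whose positions have the same
parity. -/
theorem IsLinkedPath.adj_outside_iff {T : Tournament V} (hT : T.IsCritical) {x : ℕ → V} {k : ℕ}
    (hx : T.IsLinkedPath x k) {y : V} (hy : ∀ i ≤ k, x i ≠ y) {i : ℕ} (hi : i ≤ k) :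
    T.Adj y (x i) ↔ T.Adj y (x (i % 2)) := by
  have h : ∀ r m, r + 2 * m ≤ k → (T.Adj y (x (r + 2 * m)) ↔ T.Adj y (x r)) := by
    intro r m
    induction m with
    | zero => exact fun _ => Iff.rfl
    | succ m ih =>
      intro h
      rw [← ih (by omega)]
      exact (hx.twin hT (i := r + 2 * m) (by omega) y (hy _ (by omega)).symm
        (hy _ (by omega)).symm (hy _ (by omega)).symm).symm
  have := h (i % 2) (i / 2) (by omega)
  rwa [show i % 2 + 2 * (i / 2) = i by omega] at this

/-! ### The arcs of the three tournaments -/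

theorem tournU_adj {n : ℕ} (i j : Fin (2 * n + 1)) : (tournU n).Adj i j ↔
    ((i : ℕ) % 2 = 0 ∧ (j : ℕ) % 2 = 0 ∧ (j : ℕ) < i) ∨
      (¬ ((i : ℕ) % 2 = 0 ∧ (j : ℕ) % 2 = 0) ∧ (i : ℕ) < j) := by
  have hE : ∀ v : Fin (2 * n + 1), v ∈ evens (2 * n + 1) (n + 1) ↔ (v : ℕ) % 2 = 0 := fun v =>
    ⟨fun ⟨a, _, h⟩ => by omega, fun h => ⟨v / 2, by omega, by omega⟩⟩
  simp only [tournU, invList, List.foldl, inv, std, hE, Fin.lt_def]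

theorem tournT_adj {n : ℕ} (i j : Fin (2 * n + 1)) : (tournT n).Adj i j ↔
    ((i : ℕ) % 2 = (j : ℕ) % 2 ∧ (j : ℕ) < i) ∨ ((i : ℕ) % 2 ≠ (j : ℕ) % 2 ∧ (i : ℕ) < j) := by
  have hE : ∀ v : Fin (2 * n + 1), v ∈ evens (2 * n + 1) (n + 1) ↔ (v : ℕ) % 2 = 0 := fun v =>
    ⟨fun ⟨a, _, h⟩ => by omega, fun h => ⟨v / 2, by omega, by omega⟩⟩
  have hO : ∀ v : Fin (2 * n + 1), v ∈ odds (2 * n + 1) n ↔ (v : ℕ) % 2 = 1 := fun v =>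
    ⟨fun ⟨a, _, h⟩ => by omega, fun h => ⟨v / 2, by omega, by omega⟩⟩
  simp only [tournT, invList, List.foldl, inv, std, hE, hO, Fin.lt_def]
  omega

theorem tournV_adj {n : ℕ} (i j : Fin (2 * n + 1)) : (tournV n).Adj i j ↔
    ((i : ℕ) < j ∧ ((j : ℕ) < 2 * n ∨ (i : ℕ) % 2 = 1)) ∨
      ((i : ℕ) = 2 * n ∧ (j : ℕ) < 2 * n ∧ (j : ℕ) % 2 = 0) := by
  have hE : ∀ v : Fin (2 * n + 1), v ∈ evens (2 * n + 1) (n + 1) ↔ (v : ℕ) % 2 = 0 := fun v =>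
    ⟨fun ⟨a, _, h⟩ => by omega, fun h => ⟨v / 2, by omega, by omega⟩⟩
  have hE' : ∀ v : Fin (2 * n + 1), v ∈ evens (2 * n + 1) n ↔
      (v : ℕ) % 2 = 0 ∧ (v : ℕ) < 2 * n := fun v =>
    ⟨fun ⟨a, _, h⟩ => by omega, fun h => ⟨v / 2, by omega, by omega⟩⟩
  simp only [tournV, invList, List.foldl, inv, std, hE, hE', Fin.lt_def]
  omega

/-! ### Critical tournaments belong to the three families -/

theorem isomorphic_of_adj_iff {T : Tournament V} {m : ℕ} {S : Tournament (Fin m)} {x : ℕ → V}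
    (hinj : ∀ i < m, ∀ j < m, x i = x j → i = j) (hsurj : ∀ v, ∃ i < m, x i = v)
    (h : ∀ i j : Fin m, i < j → (T.Adj (x i) (x j) ↔ S.Adj i j)) : T.Isomorphic S := by
  have hbij : Function.Bijective fun i : Fin m => x i := by
    refine ⟨fun i j hij => Fin.ext (hinj i i.2 j j.2 hij), fun v => ?_⟩
    obtain ⟨i, hi, hv⟩ := hsurj v
    exact ⟨⟨i, hi⟩, hv⟩
  refine ⟨RelIso.symm ⟨Equiv.ofBijective _ hbij, ?_⟩⟩
  intro i j
  simp only [Equiv.ofBijective_apply]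
  rcases lt_trichotomy i j with hij | rfl | hij
  · exact h i j hij
  · exact iff_of_false (T.loopless _) (S.loopless _)
  · rw [T.adj_iff_not_adj (fun e => hij.ne' (hbij.1 e)), S.adj_iff_not_adj hij.ne']
    exact not_congr (h j i hij)

/-- If no vertex of a path distinguishes two outer vertices, there is at most one outer vertex,
because the outer vertices form an interval. -/
theorem eq_of_forall_uniform {T : Tournament V} (hT : T.IsIndecomposableOn Set.univ) {x : ℕ → V}
    {k : ℕ} (h : ∀ i ≤ k, T.Uniform (x i) {y | ∀ i ≤ k, x i ≠ y}) {y z : V}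
    (hy : ∀ i ≤ k, x i ≠ y) (hz : ∀ i ≤ k, x i ≠ z) : y = z := by
  have : T.IsIntervalIn Set.univ {y | ∀ i ≤ k, x i ≠ y} := by
    refine ⟨Set.subset_univ _, fun u _ hu => ?_⟩
    simp only [Set.mem_ofPred_eq, not_forall, not_not] at hu
    obtain ⟨i, hi, rfl⟩ := hu
    exact h i hi
  rcases hT _ this with h | h
  · exact h hy hz
  · exact absurd rfl ((h.symm ▸ Set.mem_univ (x 0) : x 0 ∈ {y | ∀ i ≤ k, x i ≠ y}) 0 k.zero_le)

/-- If the longest path closes up to a cycle, the tournament is a `T_{2n+1}`. -/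
theorem IsCritical.isomorphic_tournT {T : Tournament V} (hT : T.IsCritical) {x : ℕ → V} {k : ℕ}
    (hx : T.IsLinkedPath x k) (hk : 2 ≤ k) (h0k : T.Linked (x 0) (x k))
    (h01 : T.Adj (x 0) (x 1)) : ∃ n, 2 ≤ n ∧ T.Isomorphic (tournT n) := by
  obtain ⟨-, -, hind, -⟩ := (isCritical_iff T).1 hT
  have hne : ∀ a b, a ≤ k → b ≤ k → a ≠ b → x a ≠ x b :=
    fun a b ha hb hab e => hab (hx.inj _ ha _ hb e)
  have hk0 : T.Adj (x k) (x 0) :=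
    (hT.adj_iff_of_linked h0k (hx.linked 0 (by omega)) (hne _ _ (by omega) (by omega)
      (by omega))).2 h01
  have hn0k := (T.adj_iff_not_adj h0k.1.symm).1 hk0
  have hkeven : k % 2 = 0 := by
    by_contra h
    exact hn0k (hx.adj_of_odd hT h01 (by omega) le_rfl (by omega))
  have hE : ¬ T.Adj (x 0) (x 2) := by
    rwa [hx.adj_iff_of_even hT (by omega) le_rfl (by omega)] at hn0k
  have hlast := (hx.linked (k - 1) (by omega)).symm
  rw [show k - 1 + 1 = k by omega] at hlast
  have htw1 := hT.twin_of_linked h0k.symm hlast (hne _ _ (by omega) (by omega) (by omega))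
  have htw2 := hT.twin_of_linked (hx.linked 0 (by omega)) h0k
    (hne _ _ (by omega) (by omega) (by omega))
  have hsurj : ∀ v, ∃ i ≤ k, x i = v := by
    -- The twins `x 0` and `x (k - 1)` have different parities, so the cycle is an interval.
    by_contra! hout
    obtain ⟨y, hy⟩ := hout
    have : T.IsIntervalIn Set.univ {v | ∃ i ≤ k, x i = v} := by
      refine ⟨Set.subset_univ _, fun u _ hu => ?_⟩
      simp only [Set.mem_ofPred_eq, not_exists, not_and] at hu
      have h1 : T.Adj u (x 0) ↔ T.Adj u (x 1) := by
        have := htw1 u (hu k le_rfl ·.symm) (hu 0 (by omega) ·.symm)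
          (hu (k - 1) (by omega) ·.symm)
        rwa [hx.adj_outside_iff hT hu (i := k - 1) (by omega),
          show (k - 1) % 2 = 1 by omega] at this
      have h2 : ∀ i ≤ k, (T.Adj u (x i) ↔ T.Adj u (x 0)) := by
        intro i hi
        rw [hx.adj_outside_iff hT hu hi]
        rcases Nat.mod_two_eq_zero_or_one i with h | h
        · rw [h]
        · rw [h, h1]
      rintro _ ⟨i, hi, rfl⟩ _ ⟨j, hj, rfl⟩
      rw [h2 i hi, h2 j hj]
    rcases hind _ this with h | h
    · exact hne 0 1 (by omega) (by omega) (by omega)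
        (h ⟨0, by omega, rfl⟩ ⟨1, by omega, rfl⟩)
    · obtain ⟨i, hi, hiy⟩ := (h.symm ▸ Set.mem_univ y : y ∈ {v | ∃ i ≤ k, x i = v})
      exact hy i hi hiy
  have hk4 : 4 ≤ k := by
    by_contra hk4
    have hk2 : k = 2 := by omega
    subst hk2
    obtain ⟨v, hv⟩ := hT.exists_ne (x 0) (x 1) (x 2) (x 2)
    obtain ⟨i, hi, rfl⟩ := hsurj v
    interval_cases i <;> tauto
  have hO : ¬ T.Adj (x 1) (x 3) := by
    rw [T.adj_iff_not_adj (hne _ _ (by omega) (by omega) (by omega)), not_not,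
      htw2 (x 3) (hne _ _ (by omega) (by omega) (by omega))
        (hne _ _ (by omega) (by omega) (by omega)) (hne _ _ (by omega) (by omega) (by omega))]
    exact hx.adj_of_odd hT h01 (by omega) le_rfl (by omega)
  obtain ⟨n, rfl⟩ : ∃ n, k = 2 * n := ⟨k / 2, by omega⟩
  refine ⟨n, by omega, isomorphic_of_adj_iff (x := x)
    (fun i hi j hj => hx.inj i (by omega) j (by omega)) (fun v => ?_) fun i j hij => ?_⟩
  · obtain ⟨i, hi, h⟩ := hsurj v
    exact ⟨i, by omega, h⟩
  · have hij' : (i : ℕ) < j := hij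
    rw [tournT_adj]
    by_cases hpar : (i : ℕ) % 2 = (j : ℕ) % 2
    · refine iff_of_false ?_ (by omega)
      rw [hx.adj_iff_of_even hT hij' (by omega) hpar]
      rcases Nat.mod_two_eq_zero_or_one i with h | h <;> rw [h] <;> assumption
    · exact iff_of_true (hx.adj_of_odd hT h01 hij' (by omega) hpar) (by omega)

/-- If both ends of a path have a single neighbour, the tournament is a `U_{2n+1}` or a
`V_{2n+1}`, depending on the parity of the length of the path. -/
theorem IsCritical.isomorphic_tournU_or_tournV {T : Tournament V} (hT : T.IsCritical) {x : ℕ → V}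
    {k : ℕ} (hk : 1 ≤ k) (hx : T.IsLinkedPath x k) (hu0 : T.Uniform (x 1) {x 0, x 1}ᶜ)
    (huk : T.Uniform (x (k - 1)) {x k, x (k - 1)}ᶜ) (h01 : T.Adj (x 0) (x 1)) :
    ∃ n, 2 ≤ n ∧ (T.Isomorphic (tournU n) ∨ T.Isomorphic (tournV n)) := by
  obtain ⟨-, -, hind, -⟩ := (isCritical_iff T).1 hT
  have hne : ∀ a b, a ≤ k → b ≤ k → a ≠ b → x a ≠ x b :=
    fun a b ha hb hab e => hab (hx.inj _ ha _ hb e)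
  -- Since `T` is indecomposable, it is not transitive.
  have hlin : (∀ v, ∃ i ≤ k, x i = v) → ¬ ∀ i j, i < j → j ≤ k → T.Adj (x i) (x j) := by
    intro hsurj hlt
    have : T.IsIntervalIn Set.univ {x 0, x 1} := by
      refine isIntervalIn_pair trivial trivial fun u _ h0 h1 => ?_
      obtain ⟨i, hi, rfl⟩ := hsurj u
      have hi0 : i ≠ 0 := fun e => h0 (by rw [e])
      have hi1 : i ≠ 1 := fun e => h1 (by rw [e])
      exact iff_of_false ((T.adj_iff_not_adj h0.symm).1 (hlt 0 i (by omega) hi))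
        ((T.adj_iff_not_adj h1.symm).1 (hlt 1 i (by omega) hi))
    rcases hind _ this with h | h
    · exact hne 0 1 (by omega) hk (by omega) (h (by simp) (by simp))
    · obtain ⟨v, hv⟩ := hT.exists_ne (x 0) (x 1) (x 1) (x 1)
      rcases (h.symm ▸ Set.mem_univ v : v ∈ ({x 0, x 1} : Set V)) with h | h
      exacts [hv.1 h, hv.2.1 h]
  rcases hk.eq_or_lt with rfl | hk2
  · obtain ⟨y, hy⟩ := hT.exists_ne (x 0) (x 1) (x 1) (x 1)
    obtain ⟨z, hz⟩ := hT.exists_ne (x 0) (x 1) y y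
    refine absurd (eq_of_forall_uniform hind (x := x) (k := 1) (fun i hi => ?_) ?_ ?_) hz.2.2.1
    · have hout : ∀ u ∈ {y | ∀ i ≤ 1, x i ≠ y}, u ≠ x 0 ∧ u ≠ x 1 :=
        fun u hu => ⟨(hu 0 (by omega)).symm, (hu 1 le_rfl).symm⟩
      interval_cases i
      · exact fun u hu v hv => huk u (by simpa [and_comm] using hout u hu) v
          (by simpa [and_comm] using hout v hv)
      · exact fun u hu v hv => hu0 u (by simpa using hout u hu) v (by simpa using hout v hv)
    · intro i hi
      interval_cases i
      exacts [hz.1.symm, hz.2.1.symm]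
    · intro i hi
      interval_cases i
      exacts [hy.1.symm, hy.2.1.symm]
  -- The ends of the path make `x 1` nearly a source and `x (k - 1)` nearly a sink.
  have hsrc : ∀ v, v ≠ x 0 → v ≠ x 1 → T.Adj (x 1) v := by
    intro v h0 h1
    refine (hu0 v (by simp [h0, h1]) (x 2) ?_).2 (hx.adj_of_odd hT h01 (by omega) hk2 (by omega))
    simp [hne 2 0 hk2 (by omega) (by omega), hne 2 1 hk2 (by omega) (by omega)]
  have hsnk : ∀ v, v ≠ x (k - 1) → v ≠ x k → T.Adj v (x (k - 1)) := by
    intro v h1 h0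
    rw [T.adj_iff_not_adj h1, huk v (by simp [h0, h1]) (x (k - 2)) ?_, ← T.adj_iff_not_adj]
    · exact hx.adj_of_odd hT h01 (by omega) (by omega) (by omega)
    · exact hne _ _ (by omega) (by omega) (by omega)
    · simp [hne (k - 2) k (by omega) (by omega) (by omega),
        hne (k - 2) (k - 1) (by omega) (by omega) (by omega)]
  have hO : ∀ i j, i < j → j ≤ k → i % 2 = 1 → T.Adj (x i) (x j) := by
    intro i j hij hj hi
    by_cases hpar : i % 2 = j % 2
    · rw [hx.adj_iff_of_even hT hij hj hpar, hi]
      exact hsrc _ (hne _ _ (by omega) (by omega) (by omega))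
        (hne _ _ (by omega) (by omega) (by omega))
    · exact hx.adj_of_odd hT h01 hij hj hpar
  have hsrc' : ∀ y, (∀ i ≤ k, x i ≠ y) → ¬ T.Adj y (x 1) := fun y hy =>
    (T.adj_iff_not_adj (hy 1 hk)).1 (hsrc y (hy 0 (by omega)).symm (hy 1 hk).symm)
  have hsnk' : ∀ y, (∀ i ≤ k, x i ≠ y) → T.Adj y (x (k - 1)) := fun y hy =>
    hsnk y (hy _ (by omega)).symm (hy _ le_rfl).symm
  rcases Nat.mod_two_eq_zero_or_one k with hpar | hpar
  · have hsurj : ∀ v, ∃ i ≤ k, x i = v := by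
      by_contra! hout
      obtain ⟨y, hy⟩ := hout
      have := hsnk' y hy
      rw [hx.adj_outside_iff hT hy (by omega), show (k - 1) % 2 = 1 by omega] at this
      exact hsrc' y hy this
    have hE : ¬ T.Adj (x 0) (x 2) := by
      refine fun hE => hlin hsurj fun i j hij hj => ?_
      rcases Nat.mod_two_eq_zero_or_one i with hi | hi
      · by_cases hpar : i % 2 = j % 2
        · rwa [hx.adj_iff_of_even hT hij hj hpar, hi]
        · exact hx.adj_of_odd hT h01 hij hj hpar
      · exact hO i j hij hj hi
    have hk4 : 4 ≤ k := by
      by_contra hk4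
      have hk2 : k = 2 := by omega
      subst hk2
      obtain ⟨v, hv⟩ := hT.exists_ne (x 0) (x 1) (x 2) (x 2)
      obtain ⟨i, hi, rfl⟩ := hsurj v
      interval_cases i <;> tauto
    obtain ⟨n, rfl⟩ : ∃ n, k = 2 * n := ⟨k / 2, by omega⟩
    refine ⟨n, by omega, Or.inl (isomorphic_of_adj_iff (x := x)
      (fun i hi j hj => hx.inj i (by omega) j (by omega)) (fun v => ?_) fun i j hij => ?_)⟩
    · obtain ⟨i, hi, h⟩ := hsurj v
      exact ⟨i, by omega, h⟩
    · have hij' : (i : ℕ) < j := hij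
      rw [tournU_adj]
      by_cases hev : (i : ℕ) % 2 = 0 ∧ (j : ℕ) % 2 = 0
      · refine iff_of_false ?_ (by omega)
        rwa [hx.adj_iff_of_even hT hij' (by omega) (by omega), hev.1]
      · refine iff_of_true ?_ (by omega)
        by_cases hi : (i : ℕ) % 2 = 1
        · exact hO i j hij' (by omega) hi
        · exact hx.adj_of_odd hT h01 hij' (by omega) (by omega)
  · have hlt : ∀ i j, i < j → j ≤ k → T.Adj (x i) (x j) := by
      intro i j hij hj
      rcases Nat.mod_two_eq_zero_or_one i with hi | hi
      · by_cases hpar' : i % 2 = j % 2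
        · have h := hsnk (x 0) (hne _ _ (by omega) (by omega) (by omega))
            (hne _ _ (by omega) (by omega) (by omega))
          rw [hx.adj_iff_of_even hT (by omega) (by omega) (by omega)] at h
          rwa [hx.adj_iff_of_even hT hij hj hpar', hi]
        · exact hx.adj_of_odd hT h01 hij hj hpar'
      · exact hO i j hij hj hi
    have hout : ∀ y, (∀ i ≤ k, x i ≠ y) → ∀ i ≤ k, (T.Adj y (x i) ↔ i % 2 = 0) := by
      intro y hy i hi
      have h0 := hsnk' y hy
      rw [hx.adj_outside_iff hT hy (by omega), show (k - 1) % 2 = 0 by omega] at h0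
      rw [hx.adj_outside_iff hT hy hi]
      rcases Nat.mod_two_eq_zero_or_one i with h | h <;> rw [h]
      · exact iff_of_true h0 rfl
      · exact iff_of_false (hsrc' y hy) (by omega)
    have hy : ∃ y, ∀ i ≤ k, x i ≠ y := by
      by_contra! hcon
      exact hlin hcon hlt
    obtain ⟨y, hy⟩ := hy
    have huniq : ∀ z, (∀ i ≤ k, x i ≠ z) → y = z := fun z hz => by
      refine eq_of_forall_uniform hind (fun i hi u hu v hv => ?_) hy hz
      rw [T.adj_iff_not_adj (hu i hi), T.adj_iff_not_adj (hv i hi), hout u hu i hi,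
        hout v hv i hi]
    obtain ⟨n, hn⟩ : ∃ n, k + 1 = 2 * n := ⟨(k + 1) / 2, by omega⟩
    refine ⟨n, by omega, Or.inr (isomorphic_of_adj_iff (x := fun i => if i ≤ k then x i else y)
      (fun i hi j hj hij => ?_) (fun v => ?_) fun i j hij => ?_)⟩
    · by_cases hi' : i ≤ k <;> by_cases hj' : j ≤ k <;> simp only [hi', hj', if_true, if_false] at hij
      · exact hx.inj i hi' j hj' hij
      · exact absurd hij (hy i hi')
      · exact absurd hij.symm (hy j hj')
      · omega
    · by_cases hv : ∃ i ≤ k, x i = v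
      · obtain ⟨i, hi, h⟩ := hv
        exact ⟨i, by omega, by simpa [hi] using h⟩
      · push Not at hv
        exact ⟨k + 1, by omega, by simpa using huniq v hv⟩
    · have hij' : (i : ℕ) < j := hij
      have hi : (i : ℕ) ≤ k := by omega
      rw [tournV_adj]
      by_cases hj : (j : ℕ) ≤ k
      · simp only [hi, hj, if_true]
        exact iff_of_true (hlt i j hij' hj) (by omega)
      · simp only [hi, hj, if_true, if_false]
        rw [T.adj_iff_not_adj (hy i hi), hout y hy i hi]
        omega

/-- Every critical tournament belongs to one of the three families. -/
theorem IsCritical.exists_isomorphic {T : Tournament V} (hT : T.IsCritical) : ∃ n, 2 ≤ n ∧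
    (T.Isomorphic (tournU n) ∨ T.Isomorphic (tournT n) ∨ T.Isomorphic (tournV n)) := by
  obtain ⟨x, k, hk, hx, hmax⟩ := hT.exists_longest_path
  have key : ∀ x : ℕ → V, T.IsLinkedPath x k → T.Adj (x 0) (x 1) → ∃ n, 2 ≤ n ∧
      (T.Isomorphic (tournU n) ∨ T.Isomorphic (tournT n) ∨ T.Isomorphic (tournV n)) := by
    intro x hx h01
    by_cases hcyc : 2 ≤ k ∧ T.Linked (x 0) (x k)
    · obtain ⟨n, hn, h⟩ := hT.isomorphic_tournT hx hcyc.1 hcyc.2 h01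
      exact ⟨n, hn, Or.inr (Or.inl h)⟩
    · have huk := (hT.uniform_or_linked_ends hk hx hmax).resolve_right hcyc
      have hu0 := (hT.uniform_or_linked_ends hk hx.reverse hmax).resolve_right fun h =>
        hcyc ⟨h.1, by simpa using h.2.symm⟩
      simp only [Nat.sub_self, Nat.sub_sub_self hk] at hu0
      obtain ⟨n, hn, h | h⟩ := hT.isomorphic_tournU_or_tournV hk hx hu0 huk h01
      exacts [⟨n, hn, Or.inl h⟩, ⟨n, hn, Or.inr (Or.inr h)⟩]
  -- All arcs of the path have the same direction, so the path or its reverse follows them.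
  by_cases h01 : T.Adj (x 0) (x 1)
  · exact key x hx h01
  · refine key _ hx.reverse ?_
    have h := hx.adj_succ_iff hT (i := k - 1) (by omega)
    rw [show k - 1 + 1 = k by omega] at h
    rw [Nat.sub_zero, T.adj_iff_not_adj, h]
    · exact h01
    · intro e
      have := hx.inj _ (by omega) _ (by omega) e
      omega

/-! ### The three families are critical -/

/-- A criterion for indecomposability in terms of closure: every set of positions that contains two
positions and every position distinguishing two of its members is everything. -/
theorem isIndecomposableOn_univ_of_closure {N : ℕ} {S : Tournament (Fin N)} {r : ℕ → ℕ → Prop}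
    (hr : ∀ i j : Fin N, S.Adj i j ↔ r i j)
    (h : ∀ P : ℕ → Prop,
      (∀ a b m, a < N → b < N → m < N → P a → P b → ¬ (r m a ↔ r m b) → P m) →
      ∀ i j, i < j → j < N → P i → P j → ∀ m < N, P m) :
    S.IsIndecomposableOn Set.univ := by
  rintro I ⟨-, hI⟩
  rw [or_iff_not_imp_left, Set.not_subsingleton_iff]
  intro hnt
  obtain ⟨i, hi, j, hj, hij⟩ := hnt.exists_lt
  have key := h (fun m => ∃ hm : m < N, (⟨m, hm⟩ : Fin N) ∈ I) ?_ i j hij j.2 ⟨i.2, hi⟩ ⟨j.2, hj⟩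
  · exact Set.eq_univ_of_forall fun m => (key m m.2).2
  · rintro a b m ha hb hm ⟨_, haI⟩ ⟨_, hbI⟩ hne
    refine ⟨hm, ?_⟩
    by_contra hmI
    apply hne
    rw [← hr ⟨m, hm⟩ ⟨a, ha⟩, ← hr ⟨m, hm⟩ ⟨b, hb⟩]
    exact hI _ trivial hmI _ haI _ hbI

/-- A criterion for criticality: each deletion creates a pair of twins or a source or sink. -/
theorem isCritical_of_closure {n : ℕ} (hn : 2 ≤ n) {S : Tournament (Fin (2 * n + 1))}
    {r : ℕ → ℕ → Prop} (hr : ∀ i j : Fin (2 * n + 1), S.Adj i j ↔ r i j)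
    (h : ∀ P : ℕ → Prop, (∀ a b m, a < 2 * n + 1 → b < 2 * n + 1 → m < 2 * n + 1 → P a → P b →
      ¬ (r m a ↔ r m b) → P m) →
      ∀ i j, i < j → j < 2 * n + 1 → P i → P j → ∀ m < 2 * n + 1, P m)
    (hdel : ∀ x < 2 * n + 1,
      (∃ u v, u < v ∧ v < 2 * n + 1 ∧ u ≠ x ∧ v ≠ x ∧
        ∀ w < 2 * n + 1, w ≠ x → w ≠ u → w ≠ v → (r w u ↔ r w v)) ∨
      ∃ u, u < 2 * n + 1 ∧ u ≠ x ∧ ((∀ w < 2 * n + 1, w ≠ x → w ≠ u → r u w) ∨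
        ∀ w < 2 * n + 1, w ≠ x → w ≠ u → ¬ r u w)) : S.IsCritical := by
  rw [isCritical_iff]
  refine ⟨⟨0⟩, inferInstance, isIndecomposableOn_univ_of_closure hr h, fun x hx => ?_⟩
  have h3 : 3 ≤ ({x}ᶜ : Set (Fin (2 * n + 1))).ncard := by
    rw [Set.ncard_compl, Set.ncard_singleton, Nat.card_fin]
    omega
  have hval : ∀ {w y : Fin (2 * n + 1)}, w ≠ y → (w : ℕ) ≠ y := fun h e => h (Fin.ext e)
  rcases hdel x x.2 with ⟨u, v, huv, hv, hux, hvx, htw⟩ | ⟨u, hu, hux, hun⟩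
  · refine hx.not_twin h3 (u := ⟨u, by omega⟩) (v := ⟨v, hv⟩) (fun e => hux ?_) (fun e => hvx ?_)
      (fun e => huv.ne ?_) fun w hw hwu hwv => ?_
    · exact congrArg Fin.val e
    · exact congrArg Fin.val e
    · exact congrArg Fin.val e
    · rw [hr, hr]
      exact htw w w.2 (hval hw) (hval hwu) (hval hwv)
  · refine hx.not_uniform h3 (u := ⟨u, hu⟩) (fun e => hux (congrArg Fin.val e)) ?_
    rintro w ⟨hwx, hwu⟩ w' ⟨hwx', hwu'⟩
    rw [hr, hr]
    rcases hun with hun | hun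
    · exact iff_of_true (hun w w.2 (hval hwx) (hval hwu)) (hun w' w'.2 (hval hwx') (hval hwu'))
    · exact iff_of_false (hun w w.2 (hval hwx) (hval hwu)) (hun w' w'.2 (hval hwx') (hval hwu'))

theorem tournT_isCritical {n : ℕ} (hn : 2 ≤ n) : (tournT n).IsCritical := by
  refine isCritical_of_closure hn
    (r := fun i j => (i % 2 = j % 2 ∧ j < i) ∨ (i % 2 ≠ j % 2 ∧ i < j)) tournT_adj ?_ ?_
  · intro P hP
    -- Two positions of the same parity enclose a consecutive one, and consecutive positions are
    -- distinguished by all others.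
    have hcons : ∀ i, i + 1 < 2 * n + 1 → P i → P (i + 1) → ∀ m < 2 * n + 1, P m := by
      intro i hi h0 h1 m hm
      by_cases hmi : m = i
      · rwa [hmi]
      by_cases hmi' : m = i + 1
      · rwa [hmi']
      exact hP i (i + 1) m (by omega) hi hm h0 h1 (by omega)
    have heven : ∀ i j, i < j → j < 2 * n + 1 → i % 2 = j % 2 → P i → P j →
        ∀ m < 2 * n + 1, P m := fun i j hij hj hpar h0 h1 =>
      hcons i (by omega) h0 (hP i j (i + 1) (by omega) hj (by omega) h0 h1 (by omega))
    intro i j hij hj h0 h1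
    by_cases hpar : i % 2 = j % 2
    · exact heven i j hij hj hpar h0 h1
    by_cases hj' : j = 2 * n
    · exact heven (i - 1) j (by omega) hj (by omega)
        (hP i j (i - 1) (by omega) hj (by omega) h0 h1 (by omega)) h1
    · exact heven i (j + 1) (by omega) (by omega) (by omega) h0
        (hP i j (j + 1) (by omega) hj (by omega) h0 h1 (by omega))
  · intro x hx
    left
    by_cases h0 : x = 0
    · exact ⟨1, 2 * n, by omega, by omega, by omega, by omega, fun w _ _ _ _ => by omega⟩
    by_cases h1 : x = 2 * n
    · exact ⟨0, 2 * n - 1, by omega, by omega, by omega, by omega, fun w _ _ _ _ => by omega⟩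
    · exact ⟨x - 1, x + 1, by omega, by omega, by omega, by omega, fun w _ _ _ _ => by omega⟩

theorem tournU_isCritical {n : ℕ} (hn : 2 ≤ n) : (tournU n).IsCritical := by
  refine isCritical_of_closure hn
    (r := fun i j => (i % 2 = 0 ∧ j % 2 = 0 ∧ j < i) ∨ (¬ (i % 2 = 0 ∧ j % 2 = 0) ∧ i < j))
    tournU_adj ?_ ?_
  · intro P hP
    -- Consecutive positions are distinguished by all even ones, and these yield the odd ones.
    have hcons : ∀ i, i + 1 < 2 * n + 1 → P i → P (i + 1) → ∀ m < 2 * n + 1, P m := by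
      intro i hi h0 h1
      have hev : ∀ m < 2 * n + 1, m % 2 = 0 → P m := by
        intro m hm hpar
        by_cases hmi : m = i
        · rwa [hmi]
        by_cases hmi' : m = i + 1
        · rwa [hmi']
        exact hP i (i + 1) m (by omega) hi hm h0 h1 (by omega)
      intro m hm
      by_cases hpar : m % 2 = 0
      · exact hev m hm hpar
      · exact hP 0 (2 * n) m (by omega) (by omega) hm (hev 0 (by omega) rfl)
          (hev (2 * n) (by omega) (by omega)) (by omega)
    have hnot : ∀ i j, i < j → j < 2 * n + 1 → ¬ (i % 2 = 1 ∧ j % 2 = 0) → P i → P j →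
        ∀ m < 2 * n + 1, P m := by
      intro i j hij hj hpar h0 h1
      by_cases hij' : j = i + 1
      · subst hij'
        exact hcons i hj h0 h1
      · exact hcons i (by omega) h0 (hP i j (i + 1) (by omega) hj (by omega) h0 h1 (by omega))
    intro i j hij hj h0 h1
    by_cases hpar : i % 2 = 1 ∧ j % 2 = 0
    · by_cases hij' : j = i + 1
      · subst hij'
        exact hcons i hj h0 h1
      · exact hnot i (i + 2) (by omega) (by omega) (by omega) h0
          (hP i j (i + 2) (by omega) hj (by omega) h0 h1 (by omega))
    · exact hnot i j hij hj hpar h0 h1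
  · intro x hx
    by_cases h0 : x = 0
    · exact Or.inr ⟨1, by omega, by omega, Or.inl fun w _ _ _ => by omega⟩
    by_cases h1 : x = 2 * n
    · exact Or.inr ⟨2 * n - 1, by omega, by omega, Or.inr fun w _ _ _ => by omega⟩
    · exact Or.inl ⟨x - 1, x + 1, by omega, by omega, by omega, by omega,
        fun w _ _ _ _ => by omega⟩

theorem tournV_isCritical {n : ℕ} (hn : 2 ≤ n) : (tournV n).IsCritical := by
  refine isCritical_of_closure hn
    (r := fun i j => (i < j ∧ (j < 2 * n ∨ i % 2 = 1)) ∨ (i = 2 * n ∧ j < 2 * n ∧ j % 2 = 0))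
    tournV_adj ?_ ?_
  · intro P hP
    -- The positions `2 * n` and `i` are distinguished by the larger odd and the smaller even ones.
    have hodd : ∀ i m, i < m → m < 2 * n → m % 2 = 1 → P i → P (2 * n) → P m :=
      fun i m him hm hpar h0 h1 =>
        hP i (2 * n) m (by omega) (by omega) (by omega) h0 h1 (by omega)
    have heven : ∀ i m, m < i → i < 2 * n → m % 2 = 0 → P i → P (2 * n) → P m :=
      fun i m him hi hpar h0 h1 =>
        hP i (2 * n) m (by omega) (by omega) (by omega) h0 h1 (by omega)
    have htop : ∀ i, i < 2 * n → P i → P (2 * n) → ∀ m < 2 * n + 1, P m := by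
      intro i hi h0 h1 m hm
      have hlast : P (2 * n - 1) := by
        by_cases hi' : i = 2 * n - 1
        · rwa [← hi']
        · exact hodd i _ (by omega) (by omega) (by omega) h0 h1
      have hev : ∀ m, m < 2 * n → m % 2 = 0 → P m := fun m hm hpar =>
        heven (2 * n - 1) m (by omega) (by omega) hpar hlast h1
      by_cases hm' : m = 2 * n
      · rwa [hm']
      by_cases hpar : m % 2 = 0
      · exact hev m (by omega) hpar
      · exact hodd 0 m (by omega) (by omega) (by omega) (hev 0 (by omega) rfl) h1
    intro i j hij hj h0 h1
    by_cases hj' : j = 2 * n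
    · subst hj'
      exact htop i hij h0 h1
    have h2 : P (i + 1) := by
      by_cases hij' : j = i + 1
      · rwa [← hij']
      · exact hP i j (i + 1) (by omega) hj (by omega) h0 h1 (by omega)
    exact htop i (by omega) h0
      (hP i (i + 1) (2 * n) (by omega) (by omega) (by omega) h0 h2 (by omega))
  · intro x hx
    by_cases h0 : x = 0
    · exact Or.inr ⟨1, by omega, by omega, Or.inl fun w _ _ _ => by omega⟩
    by_cases h1 : x = 2 * n - 1
    · exact Or.inr ⟨2 * n - 2, by omega, by omega, Or.inr fun w _ _ _ => by omega⟩
    by_cases h2 : x = 2 * n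
    · exact Or.inl ⟨0, 1, by omega, by omega, by omega, by omega, fun w _ _ _ _ => by omega⟩
    · exact Or.inl ⟨x - 1, x + 1, by omega, by omega, by omega, by omega,
        fun w _ _ _ _ => by omega⟩

/-! ### The three families are disjoint -/

/-- `v` has exactly one in-neighbour. -/
def HasUniqueInNeighbor (T : Tournament V) (v : V) : Prop :=
  ∃! u, T.Adj u v

theorem hasUniqueInNeighbor_iff {T : Tournament V} {S : Tournament W} (e : T.Adj ≃r S.Adj) (v : V) :
    S.HasUniqueInNeighbor (e v) ↔ T.HasUniqueInNeighbor v := by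
  simp only [HasUniqueInNeighbor, ← e.map_rel_iff]
  exact (e.toEquiv.existsUnique_congr_right).symm

theorem tournU_hasUniqueInNeighbor_iff {n : ℕ} (hn : 2 ≤ n) (v : Fin (2 * n + 1)) :
    (tournU n).HasUniqueInNeighbor v ↔ (v : ℕ) = 1 := by
  constructor
  · rintro ⟨u, -, hu⟩
    by_contra hv
    have h : ∀ a : ℕ, ∀ ha : a < 2 * n + 1, ((a % 2 = 0 ∧ (v : ℕ) % 2 = 0 ∧ (v : ℕ) < a) ∨
        (¬ (a % 2 = 0 ∧ (v : ℕ) % 2 = 0) ∧ a < v)) → a = u := fun a ha h =>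
      congrArg Fin.val (hu ⟨a, ha⟩ ((tournU_adj _ _).2 h))
    by_cases hpar : (v : ℕ) % 2 = 0
    · by_cases h0 : (v : ℕ) = 0
      · have := h 2 (by omega) (by omega)
        have := h 4 (by omega) (by omega)
        omega
      by_cases h2 : (v : ℕ) = 2
      · have := h 1 (by omega) (by omega)
        have := h 4 (by omega) (by omega)
        omega
      · have := h 1 (by omega) (by omega)
        have := h 3 (by omega) (by omega)
        omega
    · have := h 0 (by omega) (by omega)
      have := h 1 (by omega) (by omega)
      omega
  · intro hv
    refine ⟨⟨0, by omega⟩, (tournU_adj _ _).2 (by dsimp only; omega), fun u hu => Fin.ext ?_⟩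
    have := (tournU_adj _ _).1 hu
    dsimp only
    omega

theorem tournT_not_hasUniqueInNeighbor {n : ℕ} (hn : 2 ≤ n) (v : Fin (2 * n + 1)) :
    ¬ (tournT n).HasUniqueInNeighbor v := by
  rintro ⟨u, -, hu⟩
  have h : ∀ a : ℕ, ∀ ha : a < 2 * n + 1, ((a % 2 = (v : ℕ) % 2 ∧ (v : ℕ) < a) ∨
      (a % 2 ≠ (v : ℕ) % 2 ∧ a < v)) → a = u := fun a ha h =>
    congrArg Fin.val (hu ⟨a, ha⟩ ((tournT_adj _ _).2 h))
  by_cases h3 : 3 ≤ (v : ℕ)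
  · have := h (v - 1) (by omega) (by omega)
    have := h (v - 3) (by omega) (by omega)
    omega
  by_cases h0 : (v : ℕ) = 0
  · have := h 2 (by omega) (by omega)
    have := h 4 (by omega) (by omega)
    omega
  · have := h (v - 1) (by omega) (by omega)
    have := h (v + 2) (by omega) (by omega)
    omega

theorem tournV_hasUniqueInNeighbor {n : ℕ} (hn : 2 ≤ n) {v : Fin (2 * n + 1)}
    (hv : (v : ℕ) < 2) : (tournV n).HasUniqueInNeighbor v := by
  by_cases h0 : (v : ℕ) = 0
  · refine ⟨⟨2 * n, by omega⟩, (tournV_adj _ _).2 (by dsimp only; omega), fun u hu => Fin.ext ?_⟩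
    have := (tournV_adj _ _).1 hu
    dsimp only
    omega
  · refine ⟨⟨0, by omega⟩, (tournV_adj _ _).2 (by dsimp only; omega), fun u hu => Fin.ext ?_⟩
    have := (tournV_adj _ _).1 hu
    dsimp only
    omega

theorem tournU_not_isomorphic_tournT {n : ℕ} (hn : 2 ≤ n) :
    ¬ (tournU n).Isomorphic (tournT n) := fun ⟨e⟩ =>
  tournT_not_hasUniqueInNeighbor hn (e ⟨1, by omega⟩) ((hasUniqueInNeighbor_iff e _).2
    ((tournU_hasUniqueInNeighbor_iff hn _).2 rfl))

theorem tournT_not_isomorphic_tournV {n : ℕ} (hn : 2 ≤ n) :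
    ¬ (tournT n).Isomorphic (tournV n) := by
  rintro ⟨e⟩
  have h := tournV_hasUniqueInNeighbor hn (v := 0) (by simp)
  rw [← e.apply_symm_apply 0, hasUniqueInNeighbor_iff] at h
  exact tournT_not_hasUniqueInNeighbor hn _ h

theorem tournU_not_isomorphic_tournV {n : ℕ} (hn : 2 ≤ n) :
    ¬ (tournU n).Isomorphic (tournV n) := by
  rintro ⟨e⟩
  have h : ∀ v : Fin (2 * n + 1), (v : ℕ) < 2 → (e.symm v : ℕ) = 1 := by
    intro v hv
    rw [← tournU_hasUniqueInNeighbor_iff hn, ← hasUniqueInNeighbor_iff e, e.apply_symm_apply]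
    exact tournV_hasUniqueInNeighbor hn hv
  have h01 := Fin.ext ((h ⟨0, by omega⟩ (by simp)).trans (h ⟨1, by omega⟩ (by simp)).symm)
  simpa using congrArg Fin.val (e.symm.injective h01)

/-! ### Inversions and isomorphisms -/

/-- The tournament on `V` whose arcs are pulled back along a bijection. -/
def comap (S : Tournament W) (e : V ≃ W) : Tournament V where
  Adj x y := S.Adj (e x) (e y)
  loopless x := S.loopless (e x)
  adj_xor _ _ h := S.adj_xor _ _ fun h' => h (e.injective h')

theorem ext_adj {T S : Tournament V} (h : ∀ x y, T.Adj x y ↔ S.Adj x y) : T = S := by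
  obtain ⟨⟨A⟩, _, _⟩ := T
  obtain ⟨⟨B⟩, _, _⟩ := S
  have : A = B := by
    ext x y
    exact h x y
  subst this
  rfl

theorem comap_invList (S : Tournament W) (e : V ≃ W) (Xs : List (Set W)) :
    (S.invList Xs).comap e = (S.comap e).invList (Xs.map (e ⁻¹' ·)) := by
  induction Xs generalizing S with
  | nil => rfl
  | cons X Xs ih => exact ih (S.inv X)

theorem std_isAcyclic (m : ℕ) : (std m).IsAcyclic := by
  rintro ⟨x, y, z, hxy, hyz, hzx⟩
  exact lt_irrefl x (lt_trans hxy (lt_trans hyz hzx))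

/-- A tournament isomorphic to one obtained from a transitive one by inversions arises in the same
way. -/
theorem Isomorphic.exists_invList {T : Tournament V} {m : ℕ} {Xs : List (Set (Fin m))}
    (h : T.Isomorphic ((std m).invList Xs)) : ∃ (L : Tournament V) (Ys : List (Set V)),
      L.IsAcyclic ∧ Ys.length = Xs.length ∧ T = L.invList Ys := by
  obtain ⟨e⟩ := h
  refine ⟨(std m).comap e.toEquiv, Xs.map (e.toEquiv ⁻¹' ·), ?_, by simp, ?_⟩
  · rintro ⟨x, y, z, h⟩
    exact std_isAcyclic m ⟨e x, e y, e z, h⟩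
  · rw [← comap_invList]
    exact ext_adj fun _ _ => e.map_rel_iff.symm

end Tournament

theorem mainTheorem8 :
    -- the critical tournaments are, up to isomorphism, exactly the members of the three families
    (∀ (V : Type*) (T : Tournament V),
      T.IsCritical ↔
        ∃ n : ℕ, 2 ≤ n ∧
          (T.Isomorphic (Tournament.tournU n) ∨ T.Isomorphic (Tournament.tournT n) ∨
            T.Isomorphic (Tournament.tournV n))) ∧
    -- the list is irredundant
    (∀ n : ℕ, 2 ≤ n →
      ¬ (Tournament.tournU n).Isomorphic (Tournament.tournT n) ∧
      ¬ (Tournament.tournU n).Isomorphic (Tournament.tournV n) ∧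
      ¬ (Tournament.tournT n).Isomorphic (Tournament.tournV n)) ∧
    -- every critical tournament arises from an acyclic one by one or two inversions
    (∀ (V : Type*) (T : Tournament V), T.IsCritical →
      ∃ (L : Tournament V) (Xs : List (Set V)),
        L.IsAcyclic ∧ (Xs.length = 1 ∨ Xs.length = 2) ∧ T = L.invList Xs) := by
  refine ⟨fun V T => ⟨fun hT => hT.exists_isomorphic, ?_⟩, fun n hn =>
    ⟨Tournament.tournU_not_isomorphic_tournT hn, Tournament.tournU_not_isomorphic_tournV hn,
      Tournament.tournT_not_isomorphic_tournV hn⟩, fun V T hT => ?_⟩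
  · rintro ⟨n, hn, h | h | h⟩
    exacts [h.isCritical (Tournament.tournU_isCritical hn),
      h.isCritical (Tournament.tournT_isCritical hn),
      h.isCritical (Tournament.tournV_isCritical hn)]
  · obtain ⟨n, -, h | h | h⟩ := hT.exists_isomorphic
    · obtain ⟨L, Xs, hL, hXs, h⟩ := h.exists_invList
      exact ⟨L, Xs, hL, Or.inl hXs, h⟩
    · obtain ⟨L, Xs, hL, hXs, h⟩ := h.exists_invList
      exact ⟨L, Xs, hL, Or.inr hXs, h⟩
    · obtain ⟨L, Xs, hL, hXs, h⟩ := h.exists_invList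
      exact ⟨L, Xs, hL, Or.inr hXs, h⟩
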